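/- **Setting.** Fix an integer $b\ge 1$. A *bucket ordered increasing tree* of size $n\ge1$ is a rooted ordered tree each of whose vertices $v$ holds $c(v)$ labels, $1\le c(v)\le b$ (its bucket), such that every non-leaf is saturated ($c(v)=b$), each of the labels $1,\dots,n$ is used exactly once, and the labels increase within each bucket and along every path from the root to a leaf. Let $(\varphi_k)_{k\ge0}$ (degree-weights) and $(\psi_k)_{1\le k\le b-1}$ (bucket-weights) be sequences of non-negative reals with $\varphi_0>0$ and with $\varphi_k>0$ for some $k\ge2$ (so the degenerate case in which all trees are chains is excluded); put $\psi_b:=\varphi_0$. The weight $w(T)$ of a tree is the product over its vertices $v$ of $\varphi_{\deg(v)}$ if $c(v)=b$ and of $\psi_{c(v)}$ if $c(v)<b$, where $\deg(v)$ is the number of children. Let $T_n$ be the sum of the weights $w(T)$ of all bucket ordered increasing trees $T$ of size $n$. If $T_n>0$, the random tree of size $n$ of the family $\mathcal T$ given by $(\varphi,\psi)$ equals $T$ with probability $w(T)/T_n$. To *attach* the label $n+1$ to a vertex $v$ of a tree of size $n$ means to put it into the bucket of $v$ if $c(v)<b$, and, if $c(v)=b$, to let it form a new child of $v$ at one of the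 $\deg(v)+1$ possible positions, all of them equally likely. **Three models.** A tree evolution process starts with the single bucket containing label $1$; in a tree of size $n$ the label $n+1$ is attached to a vertex $v$ chosen with probability $p(v)$. (Binomial coefficients are generalized ones.) * *Bucket recursive trees:* $p(v)=\frac{c(v)}{n}$; weights $\varphi_k=\frac{(b-1)!\,b^k}{k!}$, $\psi_k=(k-1)!$. * *$(b,d)$-ary increasing trees*, $d\in\mathbb Q$, $d>1$, $(d-1)b\in\mathbb N$: $p(v)=\frac{(d-1)c(v)+1-\deg(v)}{(d-1)n+1}$; weights $\varphi_k=(b-1)!\,(d-1)^{b-1}\binom{b-1+\frac1{d-1}}{b-1}\binom{b(d-1)+1}{k}$, $\psi_k=(k-1)!\,(d-1)^{k-1}\binom{k-1+\frac1{d-1}}{k-1}$. * *$(b,\alpha)$-plane oriented recursive trees*, $\alpha>0$: $p(v)=\frac{\deg(v)+(\alpha+1)c(v)-1}{(\alpha+1)n-1}$; weights $\varphi_k=(b-1)!\,(\alpha+1)^{b-1}\binom{b-1-\frac1{\alpha+1}}{b-1}\binom{(\alpha+1)b-2+k}{k}$, $\psi_k=(k-1)!\,(\alpha+1)^{k-1}\binom{k-1-\frac1{\alpha+1}}{k-1}$.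 **Theorem.** The following properties of $(\varphi,\psi)$ are equivalent, where each of (ii)–(vi) includes the requirement that $T_n>0$ for all $n\ge1$, i.e. that the family has a random tree of every size. 1. (i) *Combinatorial model:* up to scaling the weights are those of one of the three models, i.e. there are $a,s>0$ and a model with weights $\varphi^*,\psi^*$ such that $\varphi_k=a^bs^{k-1}\varphi^*_k$ for $k\ge0$ and $\psi_k=a^ks^{-1}\psi^*_k$ for $1\le k\le b-1$. 2. (ii) *Affine linear ratio:* there are real constants $c_1,c_2$ with $T_{n+1}/T_n=c_1n+c_2$ for all $n\ge1$. 3. (iii) *Tree evolution process:* for one of the three models, the tree evolution process produces, for every $n\ge1$, the random tree of size $n$ of the family. 4. (iv) *Probabilistic growth rule:* for every tree $T'$ there are probabilities $p_{T'}(v)$, $v$ a vertex of $T'$, with sum $1$, such that for every $n\ge1$: choosing a random tree $T'$ of size $n$, then a vertex $v$ of $T'$ according to $p_{T'}$, and attaching the label $n+1$ to $v$ yields the random tree of size $n+1$. 5. (v) *Preservation of randomness:* for all $1\le j\le n$, removing all labels larger than $j$ from the random tree of size $n$ yields the random tree of size $j$. 6. (vi) *Balance:* for every $n\ge 1$ there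 is a constant $C_n$ such that for every tree $T$ of size $n$ with $w(T)\neq0$ $$\sum_{k=1}^{b-1}m_k\frac{\psi_{k+1}}{\psi_k}+\sum_{k\ge0}n_k\,(k+1)\,\psi_1\frac{\varphi_{k+1}}{\varphi_k}=C_n ,$$ where $m_k$ is the number of unsaturated vertices of $T$ with capacity $k$ and $n_k$ is the number of saturated vertices with out-degree $k$. Moreover, for each single model (with its parameter), the weights $(\varphi,\psi)$ are those of the model up to scaling if and only if the family is generated by the tree evolution process of this same model; and the weights of each of the three models satisfy the above conditions on $(\varphi,\psi)$. In particular, exactly these three parametrized families can be generated by a tree evolution process. -/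

import Mathlib

/-- Rooted ordered trees whose vertices carry a bucket (list) of labels; the order of the list of
children is relevant. The subtree hanging at a vertex also serves as the name of that vertex: in an
increasingly labelled tree different vertices have disjoint buckets, hence different subtrees. -/
inductive BucketTree : Type
  | node (bucket : List ℕ) (children : List BucketTree) : BucketTree

namespace BucketTree

/-- The bucket of the root. -/
def bucket : BucketTree → List ℕ
  | node l _ => l

/-- The subtrees hanging at the children of the root, from left to right. -/
def children : BucketTree → List BucketTree
  | node _ cs => cs

/-- The current capacity of (the root of) `v`: the number of labels in its bucket. -/
def cap (v : BucketTree) : ℕ := v.bucket.length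

/-- The out-degree of (the root of) `v`. -/
def deg (v : BucketTree) : ℕ := v.children.length

mutual
/-- All vertices of a tree in preorder, each given by the subtree hanging at it. -/
def vertices : BucketTree → List BucketTree
  | node l cs => node l cs :: verticesList cs
/-- All vertices of a list of trees. -/
def verticesList : List BucketTree → List BucketTree
  | [] => []
  | t :: ts => vertices t ++ verticesList ts
end

/-- All labels occurring in a tree, with multiplicity. -/
def labels (t : BucketTree) : List ℕ := t.vertices.flatMap bucket

/-- `t` is a bucket ordered increasing tree of size `n` with maximal bucket size `b`: buckets hold
between `1` and `b` labels, internal vertices are saturated, labels increase within each bucket and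
from each vertex to its children, and every one of the labels `1, …, n` is used exactly once. -/
structure IsIncreasing (b n : ℕ) (t : BucketTree) : Prop where
  one_le_cap : ∀ v ∈ t.vertices, 1 ≤ v.cap
  cap_le : ∀ v ∈ t.vertices, v.cap ≤ b
  saturated : ∀ v ∈ t.vertices, v.children ≠ [] → v.cap = b
  sorted : ∀ v ∈ t.vertices, v.bucket.Pairwise (· < ·)
  increasing : ∀ v ∈ t.vertices, ∀ u ∈ v.children, ∀ x ∈ v.bucket, ∀ y ∈ u.bucket, x < y
  labels_perm : t.labels.Perm (List.range' 1 n)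

theorem finite_of_bounded (B : Set (List ℕ)) (hB : B.Finite) (N : ℕ) :
    {t : BucketTree | t.vertices.length ≤ N ∧ ∀ v ∈ t.vertices, v.bucket ∈ B}.Finite := by
  induction N with
  | zero =>
    refine Set.Finite.subset Set.finite_empty ?_
    rintro ⟨l, cs⟩ ⟨h, -⟩
    simp [vertices] at h
  | succ N ih =>
    set S := {t : BucketTree | t.vertices.length ≤ N ∧ ∀ v ∈ t.vertices, v.bucket ∈ B} with hS
    have hmem : ∀ cs : List BucketTree, ∀ c ∈ cs, c.vertices.length ≤ (verticesList cs).length ∧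
        ∀ v ∈ c.vertices, v ∈ verticesList cs := by
      intro cs
      induction cs with
      | nil => simp
      | cons t ts iht =>
        intro c hc
        rcases List.mem_cons.1 hc with rfl | hc
        · simp +contextual [verticesList]
        · have h := iht c hc
          refine ⟨?_, fun v hv => ?_⟩
          · simp only [verticesList, List.length_append]
            omega
          · simp only [verticesList, List.mem_append]
            exact Or.inr (h.2 v hv)
    have hlen : ∀ cs : List BucketTree, cs.length ≤ (verticesList cs).length := by
      intro cs
      induction cs with
      | nil => simp
      | cons t ts iht =>
        have : 1 ≤ t.vertices.length := by
          cases t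
          simp [vertices]
        simp only [verticesList, List.length_append, List.length_cons]
        omega
    have : Finite S := ih.to_subtype
    have hL : {cs : List BucketTree | cs.length ≤ N ∧ ∀ c ∈ cs, c ∈ S}.Finite := by
      refine ((List.finite_length_le S N).image (List.map Subtype.val)).subset ?_
      rintro cs ⟨h1, h2⟩
      refine ⟨cs.attach.map fun c => ⟨c.1, h2 c.1 c.2⟩, by simpa using h1, ?_⟩
      simp [Function.comp_def]
    refine ((hB.prod hL).image fun p => node p.1 p.2).subset ?_
    rintro ⟨l, cs⟩ ⟨h1, h2⟩
    have h1' : (verticesList cs).length ≤ N := by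
      simpa [vertices] using h1
    refine ⟨(l, cs), ⟨h2 (node l cs) (by simp [vertices]), (hlen cs).trans h1', fun c hc => ?_⟩, rfl⟩
    refine ⟨(hmem cs c hc).1.trans h1', fun v hv => h2 v ?_⟩
    simp only [vertices, List.mem_cons]
    exact Or.inr ((hmem cs c hc).2 v hv)

theorem finite_isIncreasing (b n : ℕ) : {t : BucketTree | t.IsIncreasing b n}.Finite := by
  have hB : {l : List ℕ | l.length ≤ b ∧ ∀ x ∈ l, x ∈ Set.Iio (n + 1)}.Finite := by
    refine ((List.finite_length_le (Set.Iio (n + 1)) b).image (List.map Subtype.val)).subset ?_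
    rintro l ⟨h1, h2⟩
    refine ⟨l.attach.map fun x => ⟨x.1, h2 x.1 x.2⟩, by simpa using h1, ?_⟩
    simp [Function.comp_def]
  refine (finite_of_bounded _ hB n).subset ?_
  intro t ht
  refine ⟨?_, fun v hv => ⟨ht.cap_le v hv, fun x hx => ?_⟩⟩
  · have h := ht.labels_perm.length_eq
    rw [List.length_range', labels, List.length_flatMap] at h
    have h1 := ht.one_le_cap
    have key : ∀ L : List BucketTree, (∀ v ∈ L, 1 ≤ v.cap) →
        L.length ≤ (L.map fun v => v.bucket.length).sum := by
      intro L hL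
      induction L with
      | nil => simp
      | cons a L ih =>
        have h2 := ih fun v hv => hL v (List.mem_cons_of_mem _ hv)
        have h3 : 1 ≤ a.bucket.length := hL a List.mem_cons_self
        simp only [List.length_cons, List.map_cons, List.sum_cons]
        omega
    exact h ▸ key t.vertices h1
  · have hx' : x ∈ t.labels := List.mem_flatMap.2 ⟨v, hv, hx⟩
    have := ht.labels_perm.mem_iff.1 hx'
    rw [List.mem_range'_1] at this
    simp only [Set.mem_Iio]
    omega

/-- The bucket ordered increasing trees of size `n` with maximal bucket size `b`. -/
noncomputable def increasingTrees (b n : ℕ) : Finset BucketTree :=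
  (finite_isIncreasing b n).toFinset

/-- The weight of a vertex: `φ` of the out-degree if it is saturated, `ψ` of the capacity else. -/
noncomputable def vertexWeight (b : ℕ) (φ ψ : ℕ → ℝ) (v : BucketTree) : ℝ :=
  if v.cap < b then ψ v.cap else φ v.deg

/-- The weight of a tree: the product of the weights of its vertices. -/
noncomputable def weight (b : ℕ) (φ ψ : ℕ → ℝ) (t : BucketTree) : ℝ :=
  (t.vertices.map (vertexWeight b φ ψ)).prod

/-- The number `m_k` of unsaturated vertices of capacity `k`. -/
def numUnsaturated (b k : ℕ) (t : BucketTree) : ℕ :=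
  t.vertices.countP fun v => v.cap = k ∧ v.cap < b

/-- The number `n_k` of saturated vertices of out-degree `k`. -/
def numSaturated (b k : ℕ) (t : BucketTree) : ℕ :=
  t.vertices.countP fun v => v.cap = b ∧ v.deg = k

mutual
/-- Removal of all labels larger than `j` (and of the buckets that become empty). -/
def restrict (j : ℕ) : BucketTree → BucketTree
  | node l cs => node (l.filter (· ≤ j)) (restrictList j cs)
/-- Removal of all labels larger than `j` in a list of trees; the trees left without a label at the
root disappear. -/
def restrictList (j : ℕ) : List BucketTree → List BucketTree
  | [] => []
  | t :: ts =>
    if t.bucket.filter (· ≤ j) = [] then restrictList j ts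
    else restrict j t :: restrictList j ts
end

/-- The trees that arise when the label `x` is attached to the root of a tree: it is put into the
bucket of an unsaturated root; for a saturated root it forms a new leaf, at any of the `deg + 1`
positions among the children. -/
def attachRoot (b x : ℕ) : BucketTree → List BucketTree
  | node l cs =>
    if l.length < b then [node (l ++ [x]) cs]
    else (List.range (cs.length + 1)).map fun i => node l (cs.insertIdx i (node [x] []))

mutual
/-- All possible insertions of the label `x` into a tree, as the list of all pairs of the vertex `v`
to which `x` is attached and the tree that results from it. -/
def insertions (b x : ℕ) : BucketTree → List (BucketTree × BucketTree)
  | node l cs =>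
    (attachRoot b x (node l cs)).map (fun t => (node l cs, t)) ++
      (insertionsList b x cs).map fun g => (g.1, node l g.2)
/-- All possible insertions of the label `x` into a list of trees. -/
def insertionsList (b x : ℕ) : List BucketTree → List (BucketTree × List BucketTree)
  | [] => []
  | t :: ts =>
    (insertions b x t).map (fun g => (g.1, g.2 :: ts)) ++
      (insertionsList b x ts).map fun g => (g.1, t :: g.2)
end

/-- The number of positions at which a label can be attached to the vertex `v`. -/
def positions (b : ℕ) (v : BucketTree) : ℕ := if v.cap < b then 1 else v.deg + 1

end BucketTree

open BucketTree

/-- The standing conditions on the weights: nonnegative, `φ 0 > 0`, and not the degenerate case in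
which all trees are chains. Only the values `ψ 1, …, ψ (b - 1)` of `ψ` matter. -/
structure IsWeightPair (b : ℕ) (φ ψ : ℕ → ℝ) : Prop where
  phi_nonneg : ∀ k, 0 ≤ φ k
  phi_zero_pos : 0 < φ 0
  psi_nonneg : ∀ k, 1 ≤ k → k < b → 0 ≤ ψ k
  nondegenerate : ∃ k, 2 ≤ k ∧ 0 < φ k

/-- The total weight `T_n` of all trees of size `n`. -/
noncomputable def totalWeight (b : ℕ) (φ ψ : ℕ → ℝ) (n : ℕ) : ℝ :=
  ∑ t ∈ increasingTrees b n, weight b φ ψ t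

/-- All total weights are positive, i.e., there is a random tree of every size. -/
def HasRandomTrees (b : ℕ) (φ ψ : ℕ → ℝ) : Prop := ∀ n, 1 ≤ n → 0 < totalWeight b φ ψ n

/-- The probability of `t` in the random tree model of its size `n`. -/
noncomputable def treeProb (b : ℕ) (φ ψ : ℕ → ℝ) (n : ℕ) (t : BucketTree) : ℝ :=
  weight b φ ψ t / totalWeight b φ ψ n

/-- The bucket-weights with the convention `ψ_b = φ_0`. -/
noncomputable def bucketWeight (b : ℕ) (φ ψ : ℕ → ℝ) (k : ℕ) : ℝ := if k < b then ψ k else φ 0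

open Classical in
/-- One insertion step: `P` is the distribution of a random tree `t` of size `n`; the vertex `v` of
`t` attracts the label `n + 1` with probability `p t v`, and all positions at `v` are equally likely.
The result is the distribution of the tree of size `n + 1`. -/
noncomputable def insertionStep (b n : ℕ) (p : BucketTree → BucketTree → ℝ) (P : BucketTree → ℝ)
    (t' : BucketTree) : ℝ :=
  ∑ t ∈ increasingTrees b n, P t *
    ((insertions b (n + 1) t).map fun g =>
      if g.2 = t' then p t g.1 / (positions b g.1 : ℝ) else 0).sum

open Classical in
/-- The distribution of the tree of size `n ≥ 1` of the evolution process that starts with the single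
bucket containing the label `1` and in which, in a tree of size `n`, the vertex `v` attracts the label
`n + 1` with probability `p n v`. -/
noncomputable def evolutionLaw (b : ℕ) (p : ℕ → BucketTree → ℝ) : ℕ → BucketTree → ℝ
  | 0 => fun _ => 0
  | 1 => fun t => if t = node [1] [] then 1 else 0
  | n + 2 => insertionStep b (n + 1) (fun _ v => p (n + 1) v) (evolutionLaw b p (n + 1))

/-- The three parametrized tree models. -/
inductive TreeModel : Type
  | recursive : TreeModel
  | ary (d : ℚ) : TreeModel
  | planeOriented (α : ℝ) : TreeModel

namespace TreeModel

/-- The admissible parameters. The chains, which would correspond to `d = 1`, are left out. -/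
def Valid (b : ℕ) : TreeModel → Prop
  | recursive => True
  | ary d => 1 < d ∧ ∃ m : ℕ, (d - 1) * (b : ℚ) = (m : ℚ)
  | planeOriented α => 0 < α

/-- The degree-weights of the model. -/
noncomputable def phi (b : ℕ) : TreeModel → ℕ → ℝ
  | recursive, k => (Nat.factorial (b - 1) : ℝ) * (b : ℝ) ^ k / (Nat.factorial k : ℝ)
  | ary d, k => (Nat.factorial (b - 1) : ℝ) * ((d : ℝ) - 1) ^ (b - 1) *
      Ring.choose ((b : ℝ) - 1 + 1 / ((d : ℝ) - 1)) (b - 1) *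
      Ring.choose ((b : ℝ) * ((d : ℝ) - 1) + 1) k
  | planeOriented α, k => (Nat.factorial (b - 1) : ℝ) * (α + 1) ^ (b - 1) *
      Ring.choose ((b : ℝ) - 1 - 1 / (α + 1)) (b - 1) *
      Ring.choose ((α + 1) * (b : ℝ) - 2 + (k : ℝ)) k

/-- The bucket-weights of the model (for `1 ≤ k < b`). -/
noncomputable def psi : TreeModel → ℕ → ℝ
  | recursive, k => (Nat.factorial (k - 1) : ℝ)
  | ary d, k => (Nat.factorial (k - 1) : ℝ) * ((d : ℝ) - 1) ^ (k - 1) *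
      Ring.choose ((k : ℝ) - 1 + 1 / ((d : ℝ) - 1)) (k - 1)
  | planeOriented α, k => (Nat.factorial (k - 1) : ℝ) * (α + 1) ^ (k - 1) *
      Ring.choose ((k : ℝ) - 1 - 1 / (α + 1)) (k - 1)

/-- The probability that the vertex `v` of a tree of size `n` attracts the label `n + 1` in the tree
evolution process of the model. -/
noncomputable def attraction : TreeModel → ℕ → BucketTree → ℝ
  | recursive, n, v => (v.cap : ℝ) / (n : ℝ)
  | ary d, n, v =>
      (((d : ℝ) - 1) * (v.cap : ℝ) + 1 - (v.deg : ℝ)) / (((d : ℝ) - 1) * (n : ℝ) + 1)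
  | planeOriented α, n, v =>
      ((v.deg : ℝ) + (α + 1) * (v.cap : ℝ) - 1) / ((α + 1) * (n : ℝ) - 1)

end TreeModel

/-- The weights are, up to scaling with some `a, s > 0`, those of the model `M`. -/
def IsModelledBy (b : ℕ) (φ ψ : ℕ → ℝ) (M : TreeModel) : Prop :=
  ∃ a s : ℝ, 0 < a ∧ 0 < s ∧ (∀ k : ℕ, φ k = a ^ b * s ^ ((k : ℤ) - 1) * M.phi b k) ∧
    ∀ k : ℕ, 1 ≤ k → k < b → ψ k = a ^ k * s⁻¹ * M.psi k

/-- The family is generated by the tree evolution process of the model `M`: at every size, the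
process produces the random tree of the family. -/
def IsGeneratedBy (b : ℕ) (φ ψ : ℕ → ℝ) (M : TreeModel) : Prop :=
  HasRandomTrees b φ ψ ∧ ∀ n, 1 ≤ n → ∀ t ∈ increasingTrees b n,
    evolutionLaw b M.attraction n t = treeProb b φ ψ n t

/-- Combinatorial model. -/
def HasCombinatorialModel (b : ℕ) (φ ψ : ℕ → ℝ) : Prop :=
  ∃ M : TreeModel, M.Valid b ∧ IsModelledBy b φ ψ M

/-- Affine linear ratio of the total weights. -/
def HasAffineRatio (b : ℕ) (φ ψ : ℕ → ℝ) : Prop :=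
  HasRandomTrees b φ ψ ∧ ∃ c₁ c₂ : ℝ, ∀ n : ℕ, 1 ≤ n →
    totalWeight b φ ψ (n + 1) / totalWeight b φ ψ n = c₁ * (n : ℝ) + c₂

/-- Generation by one of the three tree evolution processes. -/
def HasTreeEvolution (b : ℕ) (φ ψ : ℕ → ℝ) : Prop :=
  ∃ M : TreeModel, M.Valid b ∧ IsGeneratedBy b φ ψ M

/-- Existence of a probabilistic growth rule: `p t v` is the probability that the vertex `v` of `t`
attracts the next label. -/
def HasGrowthRule (b : ℕ) (φ ψ : ℕ → ℝ) : Prop :=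
  HasRandomTrees b φ ψ ∧ ∃ p : BucketTree → BucketTree → ℝ, ∀ n, 1 ≤ n →
    (∀ t ∈ increasingTrees b n,
      (∀ v ∈ t.vertices, 0 ≤ p t v) ∧ (t.vertices.map (p t)).sum = 1) ∧
    ∀ t' ∈ increasingTrees b (n + 1),
      insertionStep b n p (treeProb b φ ψ n) t' = treeProb b φ ψ (n + 1) t'

open Classical in
/-- Preservation of randomness under the removal of all labels larger than `j`. -/
def PreservesRandomness (b : ℕ) (φ ψ : ℕ → ℝ) : Prop :=
  HasRandomTrees b φ ψ ∧ ∀ n j, 1 ≤ j → j ≤ n → ∀ t₀ ∈ increasingTrees b j,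
    ∑ t ∈ increasingTrees b n with restrict j t = t₀, treeProb b φ ψ n t = treeProb b φ ψ j t₀

/-- The sum in the balance condition. -/
noncomputable def connectivity (b : ℕ) (φ ψ : ℕ → ℝ) (t : BucketTree) : ℝ :=
  ∑ k ∈ Finset.Icc 1 (b - 1),
      (numUnsaturated b k t : ℝ) * (bucketWeight b φ ψ (k + 1) / bucketWeight b φ ψ k) +
    ∑ᶠ k : ℕ, (numSaturated b k t : ℝ) * ((k : ℝ) + 1) * bucketWeight b φ ψ 1 *
      (φ (k + 1) / φ k)

/-- Balance condition. It concerns the trees of the family, i.e., those of nonzero weight; for these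
no denominator vanishes in the terms with `m_k ≠ 0` or `n_k ≠ 0`. -/
def IsBalanced (b : ℕ) (φ ψ : ℕ → ℝ) : Prop :=
  HasRandomTrees b φ ψ ∧ ∀ n, 1 ≤ n → ∃ C : ℝ, ∀ t ∈ increasingTrees b n,
    weight b φ ψ t ≠ 0 → connectivity b φ ψ t = C

/-!
The theorem rests on a local form of the weights. Attaching the label `n + 1` to a vertex `v`
multiplies the weight of a tree by a factor that depends only on the capacity `c` and the out-degree
`k` of `v`. Call the weights *locally linear*, `LocalRule b φ ψ c₁ c₂`, if this factor, summed over
the positions at `v`, is `c₁ c + c₂ (1 - k)`. Since a tree has one vertex more than edges, the sum of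
these numbers over all vertices of a tree of size `n` is `c₁ n + c₂`, whatever the tree looks like.
Every tree of size `n + 1` arises by exactly one insertion, namely into its restriction to the labels
`1, …, n` (`exists_inserts_restrict`, `nodup_map_snd_insertions`). Hence the total weights have the
ratio `c₁ n + c₂`, the restriction preserves randomness, and the insertion probabilities
`(c₁ c + c₂ (1 - k)) / (c₁ n + c₂)` generate the random trees. The three models are locally linear
with `(c₁, c₂)` equal to `(1, 0)`, `(d - 1, 1)` and `(α + 1, -1)`, and scaling multiplies both
constants by the same number. Conversely, positivity of the total weights, nonnegativity of the
weights and the exclusion of chains leave only multiples of these three pairs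
(`LocalRule.hasCombinatorialModel`); here a positive `c₂` forces `c₁ b + c₂ (1 - k) = 0` for some `k`.

It remains to recover local linearity from the other properties.

* A growth rule, or preservation of randomness, makes the connectivity of a tree of size `n` equal to
  the ratio `C n` of two consecutive total weights; so the weights are balanced.
* If the weights are balanced, put trees of sizes `m₁, …, m_k` below a root of out-degree `k` with
  `φ k > 0`: then `C (b + m₁ + ⋯ + m_k)` is `C m₁ + ⋯ + C m_k` plus the contribution of the root. As
  this is possible for some `k ≥ 2`, moving one label from one subtree to another shows that `C` is
  affine, and the contribution of the root can be read off (`IsBalanced.exists_localRule`).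
* If the ratio of the total weights is affine, compare `φ` with the degree-weights that are
  computed from `φ 0` by the local rule. Both have the same total weights, and these determine the
  degree-weights one after the other, because among the trees of size `b + k` only the stars have a
  vertex of out-degree `k` or more (`phi_eq_of_totalWeight_eq`).

A family generated by the process of a model has a growth rule and so is locally linear; the
attraction of the root of a tree of size `b + 1` shows that its two constants are proportional to
those of the model (`IsGeneratedBy.isModelledBy`).
-/

namespace BucketTree

/-! ### Structural induction and the vertices of a tree -/

@[elab_as_elim]
theorem induction_on_children {P : BucketTree → Prop} (t : BucketTree)
    (h : ∀ l cs, (∀ c ∈ cs, P c) → P (node l cs)) : P t :=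
  BucketTree.rec (motive_1 := P) (motive_2 := fun cs => ∀ c ∈ cs, P c)
    (fun l cs ih => h l cs ih) (by simp) (fun t ts h1 h2 => by simpa using ⟨h1, h2⟩) t

theorem verticesList_eq_flatMap (cs : List BucketTree) :
    verticesList cs = cs.flatMap vertices := by
  induction cs with
  | nil => simp [verticesList]
  | cons t ts ih => simp [verticesList, ih]

theorem vertices_node (l : List ℕ) (cs : List BucketTree) :
    (node l cs).vertices = node l cs :: cs.flatMap vertices := by
  rw [vertices, verticesList_eq_flatMap]

theorem self_mem_vertices (t : BucketTree) : t ∈ t.vertices := by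
  cases t
  simp [vertices_node]

theorem labels_node (l : List ℕ) (cs : List BucketTree) :
    (node l cs).labels = l ++ cs.flatMap labels := by
  simp only [labels, vertices_node, List.flatMap_cons, List.flatMap_assoc, bucket]
  rfl

theorem mem_labels_of_mem_bucket {t : BucketTree} {x : ℕ} (h : x ∈ t.bucket) : x ∈ t.labels := by
  cases t
  rw [labels_node]
  exact List.mem_append_left _ h

/-- The conditions on a bucket increasing tree that concern a single vertex and its children. -/
structure IsValidAt (b : ℕ) (v : BucketTree) : Prop where
  one_le_cap : 1 ≤ v.cap
  cap_le : v.cap ≤ b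
  saturated : v.children ≠ [] → v.cap = b
  sorted : v.bucket.Pairwise (· < ·)
  increasing : ∀ u ∈ v.children, ∀ x ∈ v.bucket, ∀ y ∈ u.bucket, x < y

/-- A bucket increasing tree on an arbitrary multiset of labels: the local conditions hold at every
vertex. -/
def IsValid (b : ℕ) (t : BucketTree) : Prop := ∀ v ∈ t.vertices, IsValidAt b v

theorem isIncreasing_iff {b n : ℕ} {t : BucketTree} :
    t.IsIncreasing b n ↔ IsValid b t ∧ t.labels.Perm (List.range' 1 n) :=
  ⟨fun h => ⟨fun v hv => ⟨h.1 v hv, h.2 v hv, h.3 v hv, h.4 v hv, h.5 v hv⟩, h.6⟩,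
    fun h => ⟨fun v hv => (h.1 v hv).1, fun v hv => (h.1 v hv).2, fun v hv => (h.1 v hv).3,
      fun v hv => (h.1 v hv).4, fun v hv => (h.1 v hv).5, h.2⟩⟩

theorem mem_increasingTrees {b n : ℕ} {t : BucketTree} :
    t ∈ increasingTrees b n ↔ IsValid b t ∧ t.labels.Perm (List.range' 1 n) := by
  rw [← isIncreasing_iff]
  simp [increasingTrees]

theorem isValid_node {b : ℕ} {l : List ℕ} {cs : List BucketTree} :
    IsValid b (node l cs) ↔ IsValidAt b (node l cs) ∧ ∀ c ∈ cs, IsValid b c := by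
  constructor
  · intro h
    refine ⟨h _ (self_mem_vertices _), fun c hc v hv => h v ?_⟩
    rw [vertices_node]
    exact List.mem_cons_of_mem _ (List.mem_flatMap.2 ⟨c, hc, hv⟩)
  · rintro ⟨h1, h2⟩ v hv
    rw [vertices_node] at hv
    rcases List.mem_cons.1 hv with rfl | hv
    · exact h1
    · obtain ⟨c, hc, hv⟩ := List.mem_flatMap.1 hv
      exact h2 c hc v hv

theorem IsValidAt.children_eq_nil {b : ℕ} {v : BucketTree} (h : IsValidAt b v) (hv : v.cap < b) :
    v.children = [] := by
  by_contra hc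
  exact hv.ne (h.saturated hc)

theorem IsValidAt.exists_mem_bucket {b : ℕ} {v : BucketTree} (h : IsValidAt b v) :
    ∃ x, x ∈ v.bucket :=
  List.exists_mem_of_length_pos h.one_le_cap

theorem IsValid.self {b : ℕ} {t : BucketTree} (h : IsValid b t) : IsValidAt b t :=
  h _ (self_mem_vertices _)

/-- The smallest labels of a tree are in the bucket of the root. -/
theorem IsValid.lt_of_mem_labels {b j : ℕ} {t : BucketTree} (h : IsValid b t)
    (hj : ∀ x ∈ t.bucket, j < x) : ∀ x ∈ t.labels, j < x := by
  induction t using induction_on_children with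
  | h l cs ih =>
    obtain ⟨h1, h2⟩ := isValid_node.1 h
    intro x hx
    rw [labels_node] at hx
    rcases List.mem_append.1 hx with hx | hx
    · exact hj x hx
    · obtain ⟨c, hc, hx⟩ := List.mem_flatMap.1 hx
      obtain ⟨y, hy⟩ := h1.exists_mem_bucket
      exact ih c hc (h2 c hc) (fun z hz => (hj y hy).trans (h1.increasing c hc y hy z hz)) x hx

theorem IsValid.lt_child {b : ℕ} {l : List ℕ} {cs : List BucketTree} (h : IsValid b (node l cs))
    {c : BucketTree} (hc : c ∈ cs) {x y : ℕ} (hx : x ∈ l) (hy : y ∈ c.labels) : x < y :=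
  ((isValid_node.1 h).2 c hc).lt_of_mem_labels
    (fun z hz => (isValid_node.1 h).1.increasing c hc x hx z hz) y hy

theorem IsValid.one_le_length {b : ℕ} {t : BucketTree} (h : IsValid b t) : 1 ≤ t.labels.length := by
  obtain ⟨x, hx⟩ := h.self.exists_mem_bucket
  exact List.length_pos_of_mem (mem_labels_of_mem_bucket hx)

/-! ### Insertion of a label -/

/-- `Inserts b x t v t'` means that attaching the label `x` to the vertex `v` of the tree `t` may
result in `t'`. -/
inductive Inserts (b x : ℕ) : BucketTree → BucketTree → BucketTree → Prop
  | bucket (l : List ℕ) (cs : List BucketTree) (h : l.length < b) :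
      Inserts b x (node l cs) (node l cs) (node (l ++ [x]) cs)
  | leaf (l : List ℕ) (A B : List BucketTree) (h : ¬ l.length < b) :
      Inserts b x (node l (A ++ B)) (node l (A ++ B)) (node l (A ++ node [x] [] :: B))
  | child (l : List ℕ) (A B : List BucketTree) {c v c' : BucketTree} (h : Inserts b x c v c') :
      Inserts b x (node l (A ++ c :: B)) v (node l (A ++ c' :: B))

theorem mem_insertionsList {b x : ℕ} {cs : List BucketTree} {v : BucketTree}
    {cs' : List BucketTree} :
    (v, cs') ∈ insertionsList b x cs ↔
      ∃ A c B c', cs = A ++ c :: B ∧ (v, c') ∈ insertions b x c ∧ cs' = A ++ c' :: B := by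
  induction cs generalizing cs' with
  | nil => simp [insertionsList]
  | cons t ts ih =>
    rw [insertionsList, List.mem_append]
    constructor
    · rintro (h | h)
      · obtain ⟨g, hg, he⟩ := List.mem_map.1 h
        obtain ⟨rfl, rfl⟩ := Prod.mk.inj he
        exact ⟨[], t, ts, g.2, rfl, hg, rfl⟩
      · obtain ⟨g, hg, he⟩ := List.mem_map.1 h
        obtain ⟨rfl, rfl⟩ := Prod.mk.inj he
        obtain ⟨A, c, B, c', rfl, h1, h2⟩ := ih.1 hg
        exact ⟨t :: A, c, B, c', rfl, h1, by rw [h2]; rfl⟩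
    · rintro ⟨A, c, B, c', h1, h2, h3⟩
      cases A with
      | nil =>
        obtain ⟨rfl, rfl⟩ := List.cons.inj h1
        exact Or.inl (List.mem_map.2 ⟨(v, c'), h2, by rw [h3]; rfl⟩)
      | cons a A =>
        obtain ⟨rfl, rfl⟩ := List.cons.inj h1
        exact Or.inr (List.mem_map.2 ⟨(v, A ++ c' :: B), ih.2 ⟨A, c, B, c', rfl, h2, rfl⟩,
          by rw [h3]; rfl⟩)

theorem insertIdx_append_length (A B : List BucketTree) (t : BucketTree) :
    (A ++ B).insertIdx A.length t = A ++ t :: B := by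
  induction A with
  | nil => simp
  | cons a A ih => simp [ih]

theorem mem_attachRoot {b x : ℕ} {l : List ℕ} {cs : List BucketTree} {t : BucketTree} :
    t ∈ attachRoot b x (node l cs) ↔ (l.length < b ∧ t = node (l ++ [x]) cs) ∨
      (¬ l.length < b ∧ ∃ A B, cs = A ++ B ∧ t = node l (A ++ node [x] [] :: B)) := by
  rw [attachRoot]
  split_ifs with h
  · simp [h]
  · simp only [h, false_and, not_false_eq_true, true_and, false_or, List.mem_map, List.mem_range]
    constructor
    · rintro ⟨i, hi, rfl⟩
      refine ⟨cs.take i, cs.drop i, (List.take_append_drop i cs).symm, ?_⟩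
      have h1 := insertIdx_append_length (cs.take i) (cs.drop i) (node [x] [])
      rw [List.take_append_drop, List.length_take, min_eq_left (by omega)] at h1
      rw [h1]
    · rintro ⟨A, B, rfl, rfl⟩
      refine ⟨A.length, by simp, ?_⟩
      rw [insertIdx_append_length]

theorem mem_insertions {b x : ℕ} {t v t' : BucketTree} :
    (v, t') ∈ insertions b x t ↔ Inserts b x t v t' := by
  constructor
  · induction t using induction_on_children generalizing t' with
    | h l cs ih =>
      intro h
      rw [insertions, List.mem_append] at h
      rcases h with h | h
      · obtain ⟨u, hu, he⟩ := List.mem_map.1 h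
        obtain ⟨rfl, rfl⟩ := Prod.mk.inj he
        rcases mem_attachRoot.1 hu with ⟨hl, rfl⟩ | ⟨hl, A, B, rfl, rfl⟩
        · exact .bucket _ _ hl
        · exact .leaf _ _ _ hl
      · obtain ⟨g, hg, he⟩ := List.mem_map.1 h
        obtain ⟨rfl, rfl⟩ := Prod.mk.inj he
        obtain ⟨A, c, B, c', rfl, h1, h2⟩ := mem_insertionsList.1 hg
        rw [h2]
        exact .child _ _ _ (ih c (by simp) h1)
  · intro h
    induction h with
    | bucket l cs h =>
      rw [insertions, List.mem_append]
      exact Or.inl (List.mem_map.2 ⟨_, mem_attachRoot.2 (Or.inl ⟨h, rfl⟩), rfl⟩)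
    | leaf l A B h =>
      rw [insertions, List.mem_append]
      exact Or.inl (List.mem_map.2 ⟨_, mem_attachRoot.2 (Or.inr ⟨h, A, B, rfl, rfl⟩), rfl⟩)
    | @child l A B c v c' h ih =>
      rw [insertions, List.mem_append]
      exact Or.inr (List.mem_map.2 ⟨(v, A ++ c' :: B),
        mem_insertionsList.2 ⟨A, c, B, c', rfl, ih, rfl⟩, rfl⟩)

theorem Inserts.labels_perm {b x : ℕ} {t v t' : BucketTree} (h : Inserts b x t v t') :
    t'.labels.Perm (x :: t.labels) := by
  induction h with
  | bucket l cs h =>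
    simp only [labels_node]
    rw [List.append_assoc]
    exact List.perm_middle
  | leaf l A B h =>
    simp only [labels_node, List.flatMap_append, List.flatMap_cons, List.flatMap_nil,
      List.append_nil, List.singleton_append]
    rw [← List.append_assoc, ← List.append_assoc]
    exact List.perm_middle
  | child l A B h ih =>
    simp only [labels_node, List.flatMap_append, List.flatMap_cons]
    refine (((ih.append_right _).append_left _).append_left _).trans ?_
    rw [List.cons_append, ← List.append_assoc, ← List.append_assoc]
    exact List.perm_middle

theorem Inserts.mem_vertices {b x : ℕ} {t v t' : BucketTree} (h : Inserts b x t v t') :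
    v ∈ t.vertices := by
  induction h with
  | bucket l cs h => exact self_mem_vertices _
  | leaf l A B h => exact self_mem_vertices _
  | @child l A B c v c' h ih =>
    rw [vertices_node]
    exact List.mem_cons_of_mem _ (List.mem_flatMap.2 ⟨c, by simp, ih⟩)

theorem Inserts.mem_bucket {b x : ℕ} {t v t' : BucketTree} (h : Inserts b x t v t') {y : ℕ}
    (hy : y ∈ t'.bucket) : y ∈ t.bucket ∨ y = x := by
  cases h with
  | bucket l cs h => simpa [BucketTree.bucket] using hy
  | leaf l A B h => exact Or.inl hy
  | child l A B h => exact Or.inl hy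

theorem isValid_singleton {b x : ℕ} (hb : 1 ≤ b) : IsValid b (node [x] []) := by
  refine isValid_node.2 ⟨⟨le_rfl, hb, ?_, ?_, ?_⟩, by simp⟩ <;> simp [children, bucket]

theorem Inserts.isValid {b x : ℕ} (hb : 1 ≤ b) {t v t' : BucketTree} (h : Inserts b x t v t')
    (ht : IsValid b t) (hx : ∀ y ∈ t.labels, y < x) : IsValid b t' := by
  induction h with
  | bucket l cs h =>
    obtain ⟨h1, h2⟩ := isValid_node.1 ht
    have hcs : cs = [] := h1.children_eq_nil h
    subst hcs
    refine isValid_node.2 ⟨⟨?_, ?_, ?_, ?_, ?_⟩, by simp⟩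
    · simp [cap, BucketTree.bucket]
    · simpa [cap, BucketTree.bucket] using h
    · simp [children]
    · refine List.pairwise_append.2 ⟨h1.sorted, by simp, fun y hy z hz => ?_⟩
      rw [List.mem_singleton.1 hz]
      exact hx y (mem_labels_of_mem_bucket hy)
    · simp [children]
  | leaf l A B h =>
    obtain ⟨h1, h2⟩ := isValid_node.1 ht
    refine isValid_node.2 ⟨⟨h1.1, h1.2, fun _ => ?_, h1.4, ?_⟩, ?_⟩
    · exact le_antisymm h1.2 (not_lt.1 h)
    · intro u hu y hy z hz
      simp only [children, List.mem_append, List.mem_cons] at hu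
      rcases hu with hu | rfl | hu
      · exact h1.5 u (List.mem_append_left _ hu) y hy z hz
      · rw [List.mem_singleton.1 hz]
        exact hx y (mem_labels_of_mem_bucket hy)
      · exact h1.5 u (List.mem_append_right _ hu) y hy z hz
    · intro c hc
      simp only [List.mem_append, List.mem_cons] at hc
      rcases hc with hc | rfl | hc
      · exact h2 c (List.mem_append_left _ hc)
      · exact isValid_singleton hb
      · exact h2 c (List.mem_append_right _ hc)
  | @child l A B c v c' h ih =>
    obtain ⟨h1, h2⟩ := isValid_node.1 ht
    have hc' := ih (h2 c (by simp)) fun y hy => hx y (by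
      rw [labels_node]
      exact List.mem_append_right _ (List.mem_flatMap.2 ⟨c, by simp, hy⟩))
    refine isValid_node.2 ⟨⟨h1.1, h1.2, fun _ => h1.3 (by simp [children]), h1.4, ?_⟩, ?_⟩
    · intro u hu y hy z hz
      simp only [children, List.mem_append, List.mem_cons] at hu
      rcases hu with hu | rfl | hu
      · exact h1.5 u (by simp [children, hu]) y hy z hz
      · rcases h.mem_bucket hz with hz | rfl
        · exact h1.5 c (by simp [children]) y hy z hz
        · exact hx y (mem_labels_of_mem_bucket hy)
      · exact h1.5 u (by simp [children, hu]) y hy z hz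
    · intro u hu
      simp only [List.mem_append, List.mem_cons] at hu
      rcases hu with hu | rfl | hu
      · exact h2 u (by simp [hu])
      · exact hc'
      · exact h2 u (by simp [hu])

/-! ### Removal of large labels -/

theorem restrictList_eq (j : ℕ) (cs : List BucketTree) : restrictList j cs =
    (cs.filter fun t => t.bucket.filter (· ≤ j) ≠ []).map (restrict j) := by
  induction cs with
  | nil => simp [restrictList]
  | cons t ts ih =>
    rw [restrictList, List.filter_cons]
    split_ifs with h h' h' <;> simp_all

theorem restrictList_append (j : ℕ) (A B : List BucketTree) :
    restrictList j (A ++ B) = restrictList j A ++ restrictList j B := by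
  simp [restrictList_eq]

theorem bucket_restrict (j : ℕ) (t : BucketTree) :
    (restrict j t).bucket = t.bucket.filter (· ≤ j) := by
  cases t
  simp [restrict, bucket]

theorem mem_restrictList {j : ℕ} {cs : List BucketTree} {u : BucketTree} :
    u ∈ restrictList j cs ↔ ∃ c ∈ cs, c.bucket.filter (· ≤ j) ≠ [] ∧ restrict j c = u := by
  simp only [restrictList_eq, List.mem_map, List.mem_filter, decide_eq_true_eq, and_assoc]

theorem restrict_eq_self {b j : ℕ} {t : BucketTree} (ht : IsValid b t)
    (hj : ∀ x ∈ t.labels, x ≤ j) : restrict j t = t := by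
  induction t using induction_on_children with
  | h l cs ih =>
    have hl : ∀ c ∈ cs, ∀ x ∈ c.labels, x ≤ j := fun c hc x hx => hj x (by
      rw [labels_node]
      exact List.mem_append_right _ (List.mem_flatMap.2 ⟨c, hc, hx⟩))
    have h2 := (isValid_node.1 ht).2
    rw [restrict]
    congr 1
    · exact List.filter_eq_self.2 fun x hx => by
        simpa using hj x (mem_labels_of_mem_bucket hx)
    · rw [restrictList_eq, List.filter_eq_self.2, List.map_congr_left (g := id), List.map_id]
      · exact fun c hc => ih c hc (h2 c hc) (hl c hc)
      · intro c hc
        obtain ⟨x, hx⟩ := (h2 c hc).self.exists_mem_bucket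
        have := hl c hc x (mem_labels_of_mem_bucket hx)
        simp only [ne_eq, List.filter_eq_nil_iff, decide_eq_true_eq, not_forall, not_not]
        exact ⟨x, hx, this⟩

theorem restrictList_eq_self {b j : ℕ} {cs : List BucketTree} (h : ∀ c ∈ cs, IsValid b c)
    (hj : ∀ c ∈ cs, ∀ x ∈ c.labels, x ≤ j) : restrictList j cs = cs := by
  induction cs with
  | nil => simp [restrictList]
  | cons t ts ih =>
    have ht := h t (by simp)
    obtain ⟨x, hx⟩ := ht.self.exists_mem_bucket
    have hxj := hj t (by simp) x (mem_labels_of_mem_bucket hx)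
    rw [restrictList, if_neg, restrict_eq_self ht (hj t (by simp)),
      ih (fun c hc => h c (by simp [hc])) (fun c hc => hj c (by simp [hc]))]
    rw [List.filter_eq_nil_iff]
    exact fun H => H x hx (by simpa using hxj)

theorem restrict_restrict {i j : ℕ} (hij : i ≤ j) (t : BucketTree) :
    restrict i (restrict j t) = restrict i t := by
  have hf : ∀ l : List ℕ, (l.filter (· ≤ j)).filter (· ≤ i) = l.filter (· ≤ i) := by
    intro l
    rw [List.filter_filter]
    refine List.filter_congr fun x _ => ?_
    by_cases hx : x ≤ i
    · simp [hx, hx.trans hij]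
    · simp [hx]
  induction t using induction_on_children with
  | h l cs ih =>
    simp only [restrict]
    congr 1
    · exact hf l
    · induction cs with
      | nil => simp [restrictList]
      | cons c cs ihc =>
        have ihc := ihc fun c hc => ih c (by simp [hc])
        by_cases h1 : c.bucket.filter (· ≤ j) = []
        · have h2 : c.bucket.filter (· ≤ i) = [] := by
            rw [← hf, h1]
            rfl
          rw [restrictList, if_pos h1, restrictList, if_pos h2, ihc]
        · rw [restrictList, if_neg h1, restrictList, restrictList, bucket_restrict, hf, ihc,
            ih c (by simp)]

theorem IsValid.restrict {b j : ℕ} {t : BucketTree} (ht : IsValid b t)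
    (hj : t.bucket.filter (· ≤ j) ≠ []) : IsValid b (restrict j t) := by
  induction t using induction_on_children with
  | h l cs ih =>
    obtain ⟨h1, h2⟩ := isValid_node.1 ht
    rw [BucketTree.restrict]
    refine isValid_node.2 ⟨⟨?_, ?_, ?_, ?_, ?_⟩, ?_⟩
    · exact List.length_pos_iff.2 hj
    · exact (List.length_filter_le _ _).trans h1.cap_le
    · intro hne
      obtain ⟨u, hu⟩ := List.exists_mem_of_ne_nil _ hne
      obtain ⟨c, hc, hcj, rfl⟩ := mem_restrictList.1 hu
      obtain ⟨y, hy⟩ := List.exists_mem_of_ne_nil _ hcj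
      rw [List.mem_filter, decide_eq_true_eq] at hy
      have : l.filter (· ≤ j) = l := List.filter_eq_self.2 fun x hx => by
        simpa using (h1.increasing c hc x hx y hy.1).le.trans hy.2
      simp only [cap, bucket, this]
      exact h1.saturated (List.ne_nil_of_mem hc)
    · exact h1.sorted.filter _
    · intro u hu x hx y hy
      obtain ⟨c, hc, hcj, rfl⟩ := mem_restrictList.1 hu
      rw [bucket_restrict] at hy
      exact h1.increasing c hc x (List.mem_filter.1 hx).1 y (List.mem_filter.1 hy).1
    · intro u hu
      obtain ⟨c, hc, hcj, rfl⟩ := mem_restrictList.1 hu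
      exact ih c hc (h2 c hc) hcj

theorem Inserts.restrict_eq {b x n : ℕ} {t v t' : BucketTree} (h : Inserts b x t v t')
    (ht : IsValid b t) (hn : ∀ y ∈ t.labels, y ≤ n) (hx : n < x) : restrict n t' = t := by
  induction h with
  | bucket l cs h =>
    have h1 := restrict_eq_self ht hn
    rw [BucketTree.restrict] at h1 ⊢
    rw [List.filter_append, (node.inj h1).1, (node.inj h1).2]
    simp [hx]
  | leaf l A B h =>
    have h1 := restrict_eq_self ht hn
    rw [BucketTree.restrict] at h1 ⊢
    have h2 := (node.inj h1).2
    rw [restrictList_append] at h2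
    rw [(node.inj h1).1, restrictList_append, restrictList, if_pos, h2]
    simp [BucketTree.bucket, hx]
  | @child l A B c v c' h ih =>
    have h1 := restrict_eq_self ht hn
    have hv := (isValid_node.1 ht).2 c (by simp)
    have hl : ∀ y ∈ c.labels, y ≤ n := fun y hy => hn y (by
      rw [labels_node]
      exact List.mem_append_right _ (List.mem_flatMap.2 ⟨c, by simp, hy⟩))
    have ih := ih hv hl
    have h3 := restrict_eq_self hv hl
    rw [BucketTree.restrict] at h1 ⊢
    have h2 := (node.inj h1).2
    rw [restrictList_append, restrictList, ← bucket_restrict, h3] at h2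
    rw [(node.inj h1).1, restrictList_append, restrictList, ← bucket_restrict, ih, h2]

/-- Every tree arises from its restriction by the insertion of its largest label. -/
theorem exists_inserts_restrict {b n : ℕ} {t : BucketTree} (ht : IsValid b t)
    (hn : ∀ y ∈ t.labels, y ≤ n + 1) (hd : t.labels.Nodup) (hmem : n + 1 ∈ t.labels)
    (hne : t.bucket.filter (· ≤ n) ≠ []) : ∃ v, Inserts b (n + 1) (restrict n t) v t := by
  induction t using induction_on_children with
  | h l cs ih =>
    obtain ⟨h1, h2⟩ := isValid_node.1 ht
    have hlab : ∀ c ∈ cs, ∀ y ∈ c.labels, y ∈ (node l cs).labels := fun c hc y hy => by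
      rw [labels_node]
      exact List.mem_append_right _ (List.mem_flatMap.2 ⟨c, hc, hy⟩)
    by_cases hl : n + 1 ∈ l
    · have hcs : cs = [] := by
        rw [List.eq_nil_iff_forall_not_mem]
        intro c hc
        obtain ⟨y, hy⟩ := (h2 c hc).self.exists_mem_bucket
        have hy := mem_labels_of_mem_bucket hy
        have h3 := ht.lt_child hc hl hy
        have h4 := hn y (hlab c hc y hy)
        omega
      subst hcs
      obtain ⟨l1, l2, rfl⟩ := List.append_of_mem hl
      have hs := h1.sorted
      simp only [bucket] at hs
      rw [List.pairwise_append, List.pairwise_cons] at hs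
      have hl2 : l2 = [] := by
        rw [List.eq_nil_iff_forall_not_mem]
        intro y hy
        have h3 := hs.2.1.1 y hy
        have h4 := hn y (mem_labels_of_mem_bucket (by simp [bucket, hy]))
        omega
      subst hl2
      have hf : (l1 ++ [n + 1]).filter (· ≤ n) = l1 := by
        rw [List.filter_append, List.filter_eq_self.2]
        · simp
        · intro x hx
          have := hs.2.2 x hx (n + 1) (by simp)
          simp
          omega
      have hcap := h1.cap_le
      simp only [cap, bucket, List.length_append, List.length_singleton] at hcap
      rw [restrict, hf, restrictList]
      exact ⟨_, .bucket l1 [] (by omega)⟩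
    · have hmem' : ∃ c ∈ cs, n + 1 ∈ c.labels := by
        rw [labels_node, List.mem_append] at hmem
        exact List.mem_flatMap.1 (hmem.resolve_left hl)
      obtain ⟨c, hc, hcn⟩ := hmem'
      obtain ⟨A, B, rfl⟩ := List.append_of_mem hc
      have hfl : l.filter (· ≤ n) = l := List.filter_eq_self.2 fun x hx => by
        have h3 := hn x (mem_labels_of_mem_bucket hx)
        have h4 : x ≠ n + 1 := fun h => hl (h ▸ hx)
        simp
        omega
      rw [labels_node] at hd
      have hd' := hd.of_append_right
      rw [List.flatMap_append, List.flatMap_cons] at hd'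
      have hA : restrictList n A = A := by
        refine restrictList_eq_self (fun u hu => h2 u (by simp [hu])) fun u hu x hx => ?_
        have h3 := hn x (hlab u (by simp [hu]) x hx)
        have h4 : x ≠ n + 1 := by
          rintro rfl
          exact (List.disjoint_of_nodup_append hd') (List.mem_flatMap.2 ⟨u, hu, hx⟩)
            (List.mem_append_left _ hcn)
        omega
      have hB : restrictList n B = B := by
        refine restrictList_eq_self (fun u hu => h2 u (by simp [hu])) fun u hu x hx => ?_
        have h3 := hn x (hlab u (by simp [hu]) x hx)
        have h4 : x ≠ n + 1 := by
          rintro rfl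
          exact (List.disjoint_of_nodup_append hd'.of_append_right) hcn
            (List.mem_flatMap.2 ⟨u, hu, hx⟩)
        omega
      have hvc := h2 c (by simp)
      rw [restrict, hfl, restrictList_append, hA, restrictList, hB]
      split_ifs with hcb
      · have hbig : ∀ x ∈ c.bucket, n < x := fun x hx => by
          simpa using List.filter_eq_nil_iff.1 hcb x hx
        have hlabc : ∀ x ∈ c.labels, x = n + 1 := fun x hx => by
          have h3 := hvc.lt_of_mem_labels hbig x hx
          have h4 := hn x (hlab c (by simp) x hx)
          omega
        have hcnd : c.labels.Nodup := hd'.of_append_right.of_append_left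
        have hce : c = node [n + 1] [] := by
          obtain ⟨l', cs'⟩ := c
          obtain ⟨x, hx⟩ := hvc.self.exists_mem_bucket
          have hx1 : n + 1 ∈ l' := by
            have := hlabc x (mem_labels_of_mem_bucket hx)
            exact this ▸ hx
          have hcs' : cs' = [] := by
            rw [List.eq_nil_iff_forall_not_mem]
            intro u hu
            obtain ⟨y, hy⟩ := ((isValid_node.1 hvc).2 u hu).self.exists_mem_bucket
            have hy := mem_labels_of_mem_bucket hy
            have h3 := hvc.lt_child hu hx1 hy
            have h4 := hlabc y (by
              rw [labels_node]
              exact List.mem_append_right _ (List.mem_flatMap.2 ⟨u, hu, hy⟩))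
            omega
          subst hcs'
          rw [labels_node] at hcnd hlabc
          simp only [List.flatMap_nil, List.append_nil] at hcnd hlabc
          obtain ⟨k, hk⟩ : ∃ k, l' = List.replicate k (n + 1) :=
            ⟨_, List.eq_replicate_of_mem hlabc⟩
          subst hk
          have hk1 := List.nodup_replicate.1 hcnd
          have hk2 : k ≠ 0 := by
            rintro rfl
            simp at hx1
          obtain rfl : k = 1 := by omega
          rfl
        subst hce
        refine ⟨_, .leaf l A B ?_⟩
        have := h1.saturated (by simp [children])
        simp only [cap, bucket] at this
        omega
      · obtain ⟨v, hv⟩ := ih c (by simp) hvc (fun y hy => hn y (hlab c (by simp) y hy))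
          hd'.of_append_right.of_append_left hcn hcb
        exact ⟨v, .child l A B hv⟩

end BucketTree

namespace BucketTree

/-! ### Trees of size `n + 1` as insertions into trees of size `n` -/

theorem nodup_map_snd_insertionsList {b x : ℕ} {cs : List BucketTree}
    (h : ∀ c ∈ cs, ((insertions b x c).map Prod.snd).Nodup) (hx : ∀ c ∈ cs, x ∉ c.labels) :
    ((insertionsList b x cs).map Prod.snd).Nodup := by
  induction cs with
  | nil => simp [insertionsList]
  | cons t ts ih =>
    rw [insertionsList, List.map_append, List.map_map, List.map_map, List.nodup_append']
    refine ⟨?_, ?_, ?_⟩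
    · have := (h t (by simp)).map (f := fun u => u :: ts) fun a b hab => (List.cons.inj hab).1
      rwa [List.map_map] at this
    · have := (ih (fun c hc => h c (by simp [hc])) fun c hc => hx c (by simp [hc])).map
        (f := fun u => t :: u) fun a b hab => (List.cons.inj hab).2
      rwa [List.map_map] at this
    · intro u hu hu'
      obtain ⟨g, hg, rfl⟩ := List.mem_map.1 hu
      obtain ⟨g', hg', he⟩ := List.mem_map.1 hu'
      have h1 : t = g.2 := (List.cons.inj he).1
      have h2 := (mem_insertions.1 (show (g.1, g.2) ∈ _ from hg)).labels_perm
      exact hx t (by simp) (h1 ▸ h2.mem_iff.2 (by simp))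

/-- Different insertions of a new label yield different trees. -/
theorem nodup_map_snd_insertions {b x : ℕ} {t : BucketTree} (hx : x ∉ t.labels) :
    ((insertions b x t).map Prod.snd).Nodup := by
  induction t using induction_on_children with
  | h l cs ih =>
    have hxc : ∀ c ∈ cs, x ∉ c.labels := fun c hc h => hx (by
      rw [labels_node]
      exact List.mem_append_right _ (List.mem_flatMap.2 ⟨c, hc, h⟩))
    rw [insertions, List.map_append, List.map_map, List.map_map, List.nodup_append']
    refine ⟨?_, ?_, ?_⟩
    · have : (Prod.snd ∘ fun t => (node l cs, t)) = (id : BucketTree → BucketTree) := rfl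
      rw [this, List.map_id, attachRoot]
      split_ifs with hl
      · simp
      · refine List.Nodup.map_on ?_ List.nodup_range
        intro i hi j hj hij
        rw [List.mem_range] at hi hj
        refine List.injOn_insertIdx_index_of_notMem cs (node [x] []) (fun h => ?_)
          (show i ≤ _ by omega) (show j ≤ _ by omega) (node.inj hij).2
        exact hxc _ h (mem_labels_of_mem_bucket (by simp [bucket]))
    · have := (nodup_map_snd_insertionsList (fun c hc => ih c hc (hxc c hc)) hxc).map
        (f := node l) fun a b hab => (node.inj hab).2
      rwa [List.map_map] at this
    · intro u hu hu'
      obtain ⟨g, hg, rfl⟩ := List.mem_map.1 hu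
      obtain ⟨g', hg', he⟩ := List.mem_map.1 hu'
      obtain ⟨A, c, B, c', h1, -, h2⟩ := mem_insertionsList.1 (show (g'.1, g'.2) ∈ _ from hg')
      have he : node l g'.2 = g := he
      rcases mem_attachRoot.1 hg with ⟨-, h⟩ | ⟨-, A', B', h, h'⟩
      · have := congrArg List.length (node.inj (he.trans h)).1
        simp at this
      · have h3 := congrArg List.length (node.inj (he.trans h')).2
        have h4 := congrArg List.length h
        rw [h2] at h3
        rw [h1] at h4
        simp only [List.length_append, List.length_cons] at h3 h4
        omega

theorem lt_of_mem_labels {b n : ℕ} {t : BucketTree} (ht : t ∈ increasingTrees b n) {x : ℕ}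
    (hx : x ∈ t.labels) : x < n + 1 := by
  have := (mem_increasingTrees.1 ht).2.mem_iff.1 hx
  rw [List.mem_range'_1] at this
  omega

theorem length_labels {b n : ℕ} {t : BucketTree} (ht : t ∈ increasingTrees b n) :
    t.labels.length = n := by
  simpa using (mem_increasingTrees.1 ht).2.length_eq

theorem Inserts.mem_increasingTrees {b n : ℕ} (hb : 1 ≤ b) {t v t' : BucketTree}
    (h : Inserts b (n + 1) t v t') (ht : t ∈ increasingTrees b n) :
    t' ∈ increasingTrees b (n + 1) := by
  obtain ⟨h1, h2⟩ := BucketTree.mem_increasingTrees.1 ht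
  refine BucketTree.mem_increasingTrees.2 ⟨h.isValid hb h1 fun _ hy => lt_of_mem_labels ht hy, ?_⟩
  refine h.labels_perm.trans ((h2.cons _).trans ?_)
  rw [List.range'_1_concat, add_comm 1 n]
  exact (List.perm_append_singleton _ _).symm

theorem Inserts.restrict_of_mem {b n : ℕ} {t v t' : BucketTree}
    (h : Inserts b (n + 1) t v t') (ht : t ∈ increasingTrees b n) : restrict n t' = t :=
  h.restrict_eq (BucketTree.mem_increasingTrees.1 ht).1
    (fun _ hy => Nat.lt_succ_iff.1 (lt_of_mem_labels ht hy)) (Nat.lt_succ_self n)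

theorem exists_inserts_of_mem {b n : ℕ} (hn : 1 ≤ n) {t' : BucketTree}
    (ht' : t' ∈ increasingTrees b (n + 1)) :
    restrict n t' ∈ increasingTrees b n ∧ ∃ v, Inserts b (n + 1) (restrict n t') v t' := by
  obtain ⟨h1, h2⟩ := mem_increasingTrees.1 ht'
  have hne : t'.bucket.filter (· ≤ n) ≠ [] := by
    intro h
    have h3 : ∀ x ∈ t'.bucket, n < x := fun x hx => by
      simpa using List.filter_eq_nil_iff.1 h x hx
    have h4 := h1.lt_of_mem_labels h3 1 (h2.mem_iff.2 (by simp [List.mem_range'_1]))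
    omega
  obtain ⟨v, hv⟩ := exists_inserts_restrict h1
    (fun y hy => Nat.lt_succ_iff.1 (lt_of_mem_labels ht' hy))
    (h2.nodup_iff.2 List.nodup_range') (h2.mem_iff.2 (by simp [List.mem_range'_1])) hne
  refine ⟨mem_increasingTrees.2 ⟨h1.restrict hne, ?_⟩, v, hv⟩
  have h3 := hv.labels_perm.symm.trans h2
  rw [List.range'_1_concat, add_comm 1 n] at h3
  exact (h3.trans (List.perm_append_singleton _ _)).cons_inv

theorem notMem_labels {b n : ℕ} {t : BucketTree} (ht : t ∈ increasingTrees b n) :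
    n + 1 ∉ t.labels := fun h => (lt_of_mem_labels ht h).false

open Classical in
theorem sum_filter_restrict {b n : ℕ} (hb : 1 ≤ b) (hn : 1 ≤ n) {t : BucketTree}
    (ht : t ∈ increasingTrees b n) (f : BucketTree → ℝ) :
    ∑ t' ∈ increasingTrees b (n + 1) with restrict n t' = t, f t' =
      ((insertions b (n + 1) t).map fun g => f g.2).sum := by
  have h : {t' ∈ increasingTrees b (n + 1) | restrict n t' = t} =
      ((insertions b (n + 1) t).map Prod.snd).toFinset := by
    ext t'
    simp only [Finset.mem_filter, List.mem_toFinset, List.mem_map, Prod.exists,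
      exists_eq_right, mem_insertions]
    constructor
    · rintro ⟨h1, rfl⟩
      exact (exists_inserts_of_mem hn h1).2
    · rintro ⟨v, hv⟩
      exact ⟨hv.mem_increasingTrees hb ht, hv.restrict_of_mem ht⟩
  rw [h, List.sum_toFinset _ (nodup_map_snd_insertions (notMem_labels ht)), List.map_map]
  rfl

theorem sum_increasingTrees_succ {b n : ℕ} (hb : 1 ≤ b) (hn : 1 ≤ n) (f : BucketTree → ℝ) :
    ∑ t' ∈ increasingTrees b (n + 1), f t' =
      ∑ t ∈ increasingTrees b n, ((insertions b (n + 1) t).map fun g => f g.2).sum := by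
  classical
  rw [← Finset.sum_fiberwise_of_maps_to (g := restrict n) (t := increasingTrees b n)
    fun t' ht' => (exists_inserts_of_mem hn ht').1]
  exact Finset.sum_congr rfl fun t ht => sum_filter_restrict hb hn ht f

theorem sum_map_ite_snd {L : List (BucketTree × BucketTree)} (hL : (L.map Prod.snd).Nodup)
    {v t : BucketTree} (h : (v, t) ∈ L) (f : BucketTree × BucketTree → ℝ)
    [∀ g : BucketTree × BucketTree, Decidable (g.2 = t)] :
    (L.map fun g => if g.2 = t then f g else 0).sum = f (v, t) := by
  induction L with
  | nil => simp at h
  | cons a L ih =>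
    rw [List.map_cons, List.nodup_cons] at hL
    rw [List.map_cons, List.sum_cons]
    rcases List.mem_cons.1 h with rfl | h
    · rw [if_pos rfl, List.sum_eq_zero, add_zero]
      intro y hy
      obtain ⟨g, hg, rfl⟩ := List.mem_map.1 hy
      exact if_neg fun he => hL.1 (List.mem_map.2 ⟨g, hg, he⟩)
    · rw [ih hL.2 h, if_neg, zero_add]
      exact fun he => hL.1 (List.mem_map.2 ⟨_, h, he.symm⟩)

theorem insertionStep_eq {b n : ℕ} {t v t' : BucketTree}
    (ht : t ∈ increasingTrees b n) (h : Inserts b (n + 1) t v t')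
    (p : BucketTree → BucketTree → ℝ) (P : BucketTree → ℝ) :
    insertionStep b n p P t' = P t * (p t v / positions b v) := by
  classical
  rw [insertionStep, Finset.sum_eq_single_of_mem t ht]
  · rw [sum_map_ite_snd (nodup_map_snd_insertions (notMem_labels ht)) (mem_insertions.2 h)
      fun g => p t g.1 / (positions b g.1 : ℝ)]
  · intro u hu hut
    rw [List.sum_eq_zero, mul_zero]
    intro y hy
    obtain ⟨g, hg, rfl⟩ := List.mem_map.1 hy
    refine if_neg fun he => hut ?_
    have hg : Inserts b (n + 1) u g.1 g.2 := mem_insertions.1 hg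
    rw [← hg.restrict_of_mem hu, he, h.restrict_of_mem ht]

/-! ### Sums and products over the vertices -/

theorem sum_map_insertions_fst {b x : ℕ} (t : BucketTree) (F : BucketTree → ℝ) :
    ((insertions b x t).map fun g => F g.1).sum =
      (t.vertices.map fun v => (positions b v : ℝ) * F v).sum := by
  induction t using induction_on_children with
  | h l cs ih =>
    have h1 : ((insertionsList b x cs).map fun g => F g.1).sum =
        ((cs.flatMap vertices).map fun v => (positions b v : ℝ) * F v).sum := by
      induction cs with
      | nil => simp [insertionsList]
      | cons c cs ihc =>
        have h2 := ih c (by simp)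
        have h3 := ihc fun c hc => ih c (by simp [hc])
        simp only [insertionsList, List.map_append, List.map_map, List.sum_append,
          List.flatMap_cons]
        rw [← h2, ← h3]
        rfl
    have h4 : ((attachRoot b x (node l cs)).map fun _ => F (node l cs)).sum =
        (positions b (node l cs) : ℝ) * F (node l cs) := by
      rw [List.map_const', List.sum_replicate, nsmul_eq_mul, attachRoot, positions]
      congr 2
      by_cases hl : l.length < b
      · rw [if_pos hl, if_pos (show (node l cs).cap < b from hl)]
        simp
      · rw [if_neg hl, if_neg (show ¬ (node l cs).cap < b from hl)]
        simp [deg, children]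
    rw [vertices_node, insertions, List.map_append, List.sum_append, List.map_map, List.map_map,
      List.map_cons, List.sum_cons, ← h1, ← h4]
    rfl

theorem positions_pos (b : ℕ) (v : BucketTree) : (0 : ℝ) < positions b v := by
  rw [positions]
  split_ifs
  · simp
  · exact_mod_cast Nat.succ_pos _

theorem sum_map_vertices_node (l : List ℕ) (cs : List BucketTree) (F : BucketTree → ℝ) :
    ((node l cs).vertices.map F).sum =
      F (node l cs) + (cs.map fun c => (c.vertices.map F).sum).sum := by
  rw [vertices_node, List.map_cons, List.sum_cons]
  congr 1
  induction cs with
  | nil => simp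
  | cons c cs ih => simp [ih]

theorem weight_node (b : ℕ) (φ ψ : ℕ → ℝ) (l : List ℕ) (cs : List BucketTree) :
    weight b φ ψ (node l cs) = vertexWeight b φ ψ (node l cs) * (cs.map (weight b φ ψ)).prod := by
  rw [weight, vertices_node, List.map_cons, List.prod_cons]
  congr 1
  induction cs with
  | nil => simp
  | cons c cs ih => simp [ih, weight]

theorem sum_map_cap (t : BucketTree) :
    (t.vertices.map fun v => (v.cap : ℝ)).sum = t.labels.length := by
  rw [labels, List.length_flatMap, Nat.cast_list_sum, List.map_map]
  rfl

/-- A tree has one vertex more than it has edges. -/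
theorem sum_map_one_sub_deg (t : BucketTree) :
    (t.vertices.map fun v => 1 - (v.deg : ℝ)).sum = 1 := by
  induction t using induction_on_children with
  | h l cs ih =>
    rw [sum_map_vertices_node, List.map_congr_left ih]
    simp [deg, children]

theorem sum_map_linear (t : BucketTree) (c₁ c₂ : ℝ) :
    (t.vertices.map fun v => c₁ * (v.cap : ℝ) + c₂ * (1 - (v.deg : ℝ))).sum =
      c₁ * t.labels.length + c₂ := by
  rw [List.sum_map_add, List.sum_map_mul_left, List.sum_map_mul_left, sum_map_cap,
    sum_map_one_sub_deg, mul_one]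

/-! ### The change of the weight by an insertion -/

/-- The weight of the part of the tree that replaces the vertex `v` when a label is attached to
`v`. -/
noncomputable def attachWeight (b : ℕ) (φ ψ : ℕ → ℝ) (v : BucketTree) : ℝ :=
  if v.cap < b then bucketWeight b φ ψ (v.cap + 1) else φ (v.deg + 1) * bucketWeight b φ ψ 1

theorem weight_singleton (b : ℕ) (φ ψ : ℕ → ℝ) (l : List ℕ) :
    weight b φ ψ (node l []) = bucketWeight b φ ψ l.length := by
  simp only [weight_node, List.map_nil, List.prod_nil, mul_one]
  rfl

/-- The factor `r` by which the weight grows depends only on the vertex to which the label is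
attached. It is not written as a quotient, since vertices may have weight zero. -/
theorem Inserts.weight_eq {b x : ℕ} {φ ψ : ℕ → ℝ} {t v t' : BucketTree}
    (h : Inserts b x t v t') (ht : IsValid b t) {r : ℝ}
    (hr : attachWeight b φ ψ v = r * vertexWeight b φ ψ v) :
    weight b φ ψ t' = r * weight b φ ψ t := by
  induction h with
  | bucket l cs h =>
    have hcs : cs = [] := (isValid_node.1 ht).1.children_eq_nil h
    subst hcs
    rw [attachWeight, if_pos (show (node l []).cap < b from h)] at hr
    rw [weight_singleton, weight_node, List.length_append, List.length_singleton]
    simpa [cap, BucketTree.bucket] using hr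
  | leaf l A B h =>
    rw [attachWeight, if_neg (show ¬ (node l (A ++ B)).cap < b from h)] at hr
    have h1 : vertexWeight b φ ψ (node l (A ++ node [x] [] :: B)) =
        φ ((node l (A ++ B)).deg + 1) := by
      rw [vertexWeight, if_neg (show ¬ (node l (A ++ node [x] [] :: B)).cap < b from h)]
      simp [deg, children, add_assoc]
    rw [weight_node, weight_node, h1]
    simp only [List.map_append, List.map_cons, List.prod_append, List.prod_cons, weight_singleton,
      List.length_singleton]
    linear_combination ((A.map (weight b φ ψ)).prod * (B.map (weight b φ ψ)).prod) * hr
  | @child l A B c v c' h ih =>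
    have ih := ih ((isValid_node.1 ht).2 c (by simp)) hr
    have h1 : vertexWeight b φ ψ (node l (A ++ c' :: B)) =
        vertexWeight b φ ψ (node l (A ++ c :: B)) := by
      simp [vertexWeight, deg, cap, children, BucketTree.bucket]
    rw [weight_node, weight_node, h1]
    simp only [List.map_append, List.map_cons, List.prod_append, List.prod_cons, ih]
    ring

theorem vertexWeight_ne_zero {b : ℕ} {φ ψ : ℕ → ℝ} {t v : BucketTree}
    (ht : weight b φ ψ t ≠ 0) (hv : v ∈ t.vertices) : vertexWeight b φ ψ v ≠ 0 := by
  intro h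
  exact ht (List.prod_eq_zero (List.mem_map.2 ⟨v, hv, h⟩))

/-- The contribution of a vertex to the connectivity: the total factor, over all positions, by which
the weight grows when a label is attached to `v`. -/
noncomputable def vertexConnectivity (b : ℕ) (φ ψ : ℕ → ℝ) (v : BucketTree) : ℝ :=
  positions b v * (attachWeight b φ ψ v / vertexWeight b φ ψ v)

theorem sum_weight_insertions {b x : ℕ} {φ ψ : ℕ → ℝ} {t : BucketTree} (ht : IsValid b t)
    (h0 : weight b φ ψ t ≠ 0) :
    ((insertions b x t).map fun g => weight b φ ψ g.2).sum =
      weight b φ ψ t * (t.vertices.map (vertexConnectivity b φ ψ)).sum := by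
  have h1 : (insertions b x t).map (fun g => weight b φ ψ g.2) = (insertions b x t).map
      fun g => attachWeight b φ ψ g.1 / vertexWeight b φ ψ g.1 * weight b φ ψ t := by
    refine List.map_congr_left fun g hg => ?_
    have hg : Inserts b x t g.1 g.2 := mem_insertions.1 hg
    exact hg.weight_eq ht (div_mul_cancel₀ _ (vertexWeight_ne_zero h0 hg.mem_vertices)).symm
  rw [h1, List.sum_map_mul_right, sum_map_insertions_fst t fun v => attachWeight b φ ψ v /
    vertexWeight b φ ψ v, mul_comm]
  rfl

theorem sum_countP_unsaturated {b : ℕ} {L : List BucketTree} (hL : ∀ v ∈ L, IsValidAt b v)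
    (A : ℕ → ℝ) :
    ∑ k ∈ Finset.Icc 1 (b - 1), (L.countP (fun v => v.cap = k ∧ v.cap < b) : ℝ) * A k =
      (L.map fun v => if v.cap < b then A v.cap else 0).sum := by
  induction L with
  | nil => simp
  | cons v L ih =>
    have hcap := (hL v (by simp)).one_le_cap
    rw [List.map_cons, List.sum_cons, ← ih fun u hu => hL u (by simp [hu])]
    simp only [List.countP_cons, Nat.cast_add, add_mul, Finset.sum_add_distrib]
    rw [add_comm]
    congr 1
    split_ifs with hb
    · rw [Finset.sum_eq_single_of_mem v.cap (Finset.mem_Icc.2 ⟨hcap, by omega⟩)]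
      · simp [hb]
      · intro k _ hk
        simp [Ne.symm hk]
    · simp [hb]

theorem finsum_countP_saturated (b : ℕ) (L : List BucketTree) (B : ℕ → ℝ) :
    ∑ᶠ k : ℕ, (L.countP (fun v => v.cap = b ∧ v.deg = k) : ℝ) * B k =
      (L.map fun v => if v.cap = b then B v.deg else 0).sum := by
  have hfin : ∀ L : List BucketTree, (Function.support fun k : ℕ =>
      (L.countP (fun v => v.cap = b ∧ v.deg = k) : ℝ) * B k).Finite := by
    intro L
    refine (L.map deg).toFinset.finite_toSet.subset fun k hk => ?_
    by_contra hk'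
    refine hk ?_
    have : L.countP (fun v => v.cap = b ∧ v.deg = k) = 0 := by
      rw [List.countP_eq_zero]
      intro v hv h
      exact hk' (by simpa using ⟨v, hv, (of_decide_eq_true h).2⟩)
    simp only [this, Nat.cast_zero, zero_mul]
  induction L with
  | nil => simp
  | cons v L ih =>
    rw [List.map_cons, List.sum_cons, ← ih]
    have h1 : ∀ k, ((v :: L).countP (fun v => v.cap = b ∧ v.deg = k) : ℝ) * B k =
        ([v].countP (fun v => v.cap = b ∧ v.deg = k) : ℝ) * B k +
        (L.countP (fun v => v.cap = b ∧ v.deg = k) : ℝ) * B k := by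
      intro k
      rw [← add_mul, ← Nat.cast_add, ← List.countP_append]
      rfl
    rw [finsum_congr h1, finsum_add_distrib (hfin [v]) (hfin L)]
    congr 1
    rw [finsum_eq_single _ v.deg]
    · simp [List.countP_cons]
    · intro k hk
      simp [Ne.symm hk]

/-- The connectivity of a tree, collected vertex by vertex instead of by types of vertices. -/
theorem connectivity_eq {b : ℕ} {φ ψ : ℕ → ℝ} {t : BucketTree} (ht : IsValid b t) :
    connectivity b φ ψ t = (t.vertices.map (vertexConnectivity b φ ψ)).sum := by
  have h1 := sum_countP_unsaturated ht fun k => bucketWeight b φ ψ (k + 1) / bucketWeight b φ ψ k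
  have h2 := finsum_countP_saturated b t.vertices
    fun k => ((k : ℝ) + 1) * bucketWeight b φ ψ 1 * (φ (k + 1) / φ k)
  simp only [connectivity, numUnsaturated, numSaturated]
  simp only [← mul_assoc] at h2
  rw [h1, h2, ← List.sum_map_add]
  refine congrArg _ (List.map_congr_left fun v hv => ?_)
  have hle := (ht v hv).cap_le
  by_cases hb : v.cap < b
  · simp [vertexConnectivity, hb, hb.ne, attachWeight, positions, vertexWeight, bucketWeight]
  · simp [vertexConnectivity, le_antisymm hle (not_lt.1 hb), attachWeight, positions,
      vertexWeight]
    ring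

end BucketTree

namespace BucketTree

/-! ### Small trees and trees with prescribed subtrees of the root -/

theorem length_flatMap_labels_ge {b : ℕ} {cs : List BucketTree} (h : ∀ c ∈ cs, IsValid b c) :
    cs.length ≤ (cs.flatMap labels).length := by
  induction cs with
  | nil => simp
  | cons c cs ih =>
    have h1 := (h c (by simp)).one_le_length
    have h2 := ih fun c hc => h c (by simp [hc])
    simp only [List.length_cons, List.flatMap_cons, List.length_append]
    omega

theorem IsValid.cap_add_deg_le {b : ℕ} {t : BucketTree} (h : IsValid b t) :
    t.cap + t.deg ≤ t.labels.length := by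
  obtain ⟨l, cs⟩ := t
  have := length_flatMap_labels_ge (isValid_node.1 h).2
  rw [labels_node, List.length_append]
  exact Nat.add_le_add_left this _

theorem IsValid.children_eq_nil {b : ℕ} {t : BucketTree} (h : IsValid b t)
    (hb : t.labels.length ≤ b) : t.children = [] := by
  by_contra hc
  have h1 := h.cap_add_deg_le
  have h2 := h.self.saturated hc
  have h3 : 1 ≤ t.deg := List.length_pos_iff.2 hc
  omega

theorem isValid_bucket {b s n : ℕ} (hn : 1 ≤ n) (hnb : n ≤ b) :
    IsValid b (node (List.range' s n) []) := by
  refine isValid_node.2 ⟨⟨?_, ?_, ?_, ?_, ?_⟩, by simp⟩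
  · simpa [cap, bucket] using hn
  · simpa [cap, bucket] using hnb
  · simp [children]
  · exact List.pairwise_lt_range'
  · simp [children]

theorem bucket_mem_increasingTrees {b n : ℕ} (hn : 1 ≤ n) (hnb : n ≤ b) :
    node (List.range' 1 n) [] ∈ increasingTrees b n :=
  mem_increasingTrees.2 ⟨isValid_bucket hn hnb, by simp [labels_node]⟩

theorem increasingTrees_eq_singleton {b n : ℕ} (hn : 1 ≤ n) (hnb : n ≤ b) :
    increasingTrees b n = {node (List.range' 1 n) []} := by
  ext t
  rw [Finset.mem_singleton]
  constructor
  · intro ht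
    obtain ⟨h1, h2⟩ := mem_increasingTrees.1 ht
    have h3 := h1.children_eq_nil (by rw [length_labels ht]; exact hnb)
    obtain ⟨l, cs⟩ := t
    obtain rfl : cs = [] := h3
    rw [labels_node, List.flatMap_nil, List.append_nil] at h2
    rw [show l = List.range' 1 n from h2.eq_of_pairwise (fun a b _ _ h h' => absurd h h'.asymm)
      h1.self.sorted List.pairwise_lt_range']
  · rintro rfl
    exact bucket_mem_increasingTrees hn hnb

mutual
/-- The tree with all labels increased by `s`. -/
def shift (s : ℕ) : BucketTree → BucketTree
  | node l cs => node (l.map (s + ·)) (shiftList s cs)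
/-- The trees of a list with all labels increased by `s`. -/
def shiftList (s : ℕ) : List BucketTree → List BucketTree
  | [] => []
  | t :: ts => shift s t :: shiftList s ts
end

theorem shiftList_eq_map (s : ℕ) (cs : List BucketTree) : shiftList s cs = cs.map (shift s) := by
  induction cs with
  | nil => simp [shiftList]
  | cons c cs ih => simp [shiftList, ih]

theorem bucket_shift (s : ℕ) (t : BucketTree) : (shift s t).bucket = t.bucket.map (s + ·) := by
  cases t
  simp [shift, bucket]

theorem children_shift (s : ℕ) (t : BucketTree) :
    (shift s t).children = t.children.map (shift s) := by
  cases t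
  simp [shift, children, shiftList_eq_map]

theorem cap_shift (s : ℕ) (t : BucketTree) : (shift s t).cap = t.cap := by
  simp [cap, bucket_shift]

theorem deg_shift (s : ℕ) (t : BucketTree) : (shift s t).deg = t.deg := by
  simp [deg, children_shift]

theorem vertices_shift (s : ℕ) (t : BucketTree) :
    (shift s t).vertices = t.vertices.map (shift s) := by
  induction t using induction_on_children with
  | h l cs ih =>
    rw [vertices_node, shift, vertices_node, List.map_cons, shift, shiftList_eq_map]
    congr 1
    induction cs with
    | nil => simp
    | cons c cs ihc =>
      simp only [List.map_cons, List.flatMap_cons, List.map_append]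
      rw [ih c (by simp), ihc fun c hc => ih c (by simp [hc])]

theorem labels_shift (s : ℕ) (t : BucketTree) : (shift s t).labels = t.labels.map (s + ·) := by
  rw [labels, labels, vertices_shift, List.map_flatMap, List.flatMap_map]
  simp only [bucket_shift]

theorem IsValid.shift {b : ℕ} {t : BucketTree} (h : IsValid b t) (s : ℕ) :
    IsValid b (shift s t) := by
  intro v hv
  rw [vertices_shift] at hv
  obtain ⟨u, hu, rfl⟩ := List.mem_map.1 hv
  have hu := h u hu
  refine ⟨?_, ?_, ?_, ?_, ?_⟩
  · rw [cap_shift]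
    exact hu.1
  · rw [cap_shift]
    exact hu.2
  · rw [cap_shift, children_shift]
    exact fun h => hu.3 (by simpa using h)
  · rw [bucket_shift, List.pairwise_map]
    exact hu.4.imp fun h => Nat.add_lt_add_left h s
  · intro w hw x hx y hy
    rw [children_shift] at hw
    obtain ⟨w, hw', rfl⟩ := List.mem_map.1 hw
    rw [bucket_shift] at hx hy
    obtain ⟨x, hx', rfl⟩ := List.mem_map.1 hx
    obtain ⟨y, hy', rfl⟩ := List.mem_map.1 hy
    exact Nat.add_lt_add_left (hu.5 w hw' x hx' y hy') s

theorem weight_shift (b : ℕ) (φ ψ : ℕ → ℝ) (s : ℕ) (t : BucketTree) :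
    weight b φ ψ (shift s t) = weight b φ ψ t := by
  rw [weight, weight, vertices_shift, List.map_map]
  refine congrArg _ (List.map_congr_left fun v _ => ?_)
  simp [vertexWeight, cap_shift, deg_shift]

theorem sum_vertexConnectivity_shift (b : ℕ) (φ ψ : ℕ → ℝ) (s : ℕ) (t : BucketTree) :
    ((shift s t).vertices.map (vertexConnectivity b φ ψ)).sum =
      (t.vertices.map (vertexConnectivity b φ ψ)).sum := by
  rw [vertices_shift, List.map_map]
  refine congrArg _ (List.map_congr_left fun v _ => ?_)
  simp [vertexConnectivity, attachWeight, positions, vertexWeight, cap_shift, deg_shift]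

/-- The trees of a list, relabelled one after the other such that they use consecutive intervals of
labels, the first of which begins at `s + 1`. -/
def shiftConsecutive : ℕ → List BucketTree → List BucketTree
  | _, [] => []
  | s, t :: ts => shift s t :: shiftConsecutive (s + t.labels.length) ts

/-- The tree with root bucket `1, …, b` and the given trees, relabelled by consecutive intervals, as
subtrees of the root. -/
def graft (b : ℕ) (ts : List BucketTree) : BucketTree :=
  node (List.range' 1 b) (shiftConsecutive b ts)

theorem mem_shiftConsecutive {s : ℕ} {ts : List BucketTree} {u : BucketTree}
    (h : u ∈ shiftConsecutive s ts) : ∃ t ∈ ts, ∃ r, s ≤ r ∧ u = shift r t := by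
  induction ts generalizing s with
  | nil => simp [shiftConsecutive] at h
  | cons t ts ih =>
    rw [shiftConsecutive, List.mem_cons] at h
    rcases h with rfl | h
    · exact ⟨t, by simp, s, le_rfl, rfl⟩
    · obtain ⟨u, hu, r, hr, h⟩ := ih h
      exact ⟨u, by simp [hu], r, by omega, h⟩

theorem map_shiftConsecutive {α : Type*} {F : BucketTree → α} (hF : ∀ s t, F (shift s t) = F t)
    (s : ℕ) (ts : List BucketTree) : (shiftConsecutive s ts).map F = ts.map F := by
  induction ts generalizing s with
  | nil => simp [shiftConsecutive]
  | cons t ts ih => simp [shiftConsecutive, hF, ih]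

theorem labels_shiftConsecutive {s : ℕ} {ts : List BucketTree}
    (h : ∀ t ∈ ts, t.labels.Perm (List.range' 1 t.labels.length)) :
    ((shiftConsecutive s ts).flatMap labels).Perm
      (List.range' (1 + s) (ts.map fun t => t.labels.length).sum) := by
  induction ts generalizing s with
  | nil => simp [shiftConsecutive]
  | cons t ts ih =>
    rw [shiftConsecutive, List.flatMap_cons, List.map_cons, List.sum_cons, ← List.range'_append_1,
      labels_shift]
    refine List.Perm.append ?_ ?_
    · refine ((h t (by simp)).map _).trans ?_
      rw [List.map_add_range', add_comm s]
    · rw [add_assoc]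
      exact ih fun t ht => h t (by simp [ht])

theorem graft_mem_increasingTrees {b : ℕ} (hb : 1 ≤ b) {ts : List BucketTree}
    (h : ∀ t ∈ ts, t ∈ increasingTrees b t.labels.length) :
    graft b ts ∈ increasingTrees b (b + (ts.map fun t => t.labels.length).sum) := by
  refine mem_increasingTrees.2 ⟨isValid_node.2 ⟨⟨?_, ?_, ?_, ?_, ?_⟩, ?_⟩, ?_⟩
  · simpa [cap, bucket] using hb
  · simp [cap, bucket]
  · simp [cap, bucket]
  · exact List.pairwise_lt_range'
  · intro u hu x hx y hy
    obtain ⟨t, ht, r, hr, rfl⟩ := mem_shiftConsecutive hu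
    rw [bucket_shift] at hy
    obtain ⟨y, hy', rfl⟩ := List.mem_map.1 hy
    have h1 := (mem_increasingTrees.1 (h t ht)).2.mem_iff.1 (mem_labels_of_mem_bucket hy')
    have h2 : x ∈ List.range' 1 b := hx
    rw [List.mem_range'_1] at h1 h2
    omega
  · intro u hu
    obtain ⟨t, ht, r, hr, rfl⟩ := mem_shiftConsecutive hu
    exact (mem_increasingTrees.1 (h t ht)).1.shift r
  · rw [graft, labels_node, ← List.range'_append_1]
    exact (labels_shiftConsecutive fun t ht => (mem_increasingTrees.1 (h t ht)).2).append_left _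

theorem deg_graft (b : ℕ) (ts : List BucketTree) : (graft b ts).deg = ts.length := by
  have := congrArg List.length (map_shiftConsecutive (F := fun _ => ()) (fun _ _ => rfl) b ts)
  simpa [graft, deg, children] using this

theorem cap_graft (b : ℕ) (ts : List BucketTree) : (graft b ts).cap = b := by
  simp [graft, cap, bucket]

theorem weight_graft (b : ℕ) (φ ψ : ℕ → ℝ) (ts : List BucketTree) :
    weight b φ ψ (graft b ts) = φ ts.length * (ts.map (weight b φ ψ)).prod := by
  rw [graft, weight_node, map_shiftConsecutive (weight_shift b φ ψ), ← graft, vertexWeight,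
    cap_graft, if_neg (lt_irrefl b), deg_graft]

theorem sum_vertexConnectivity_graft (b : ℕ) (φ ψ : ℕ → ℝ) (ts : List BucketTree) :
    ((graft b ts).vertices.map (vertexConnectivity b φ ψ)).sum =
      ((ts.length : ℝ) + 1) * (φ (ts.length + 1) * bucketWeight b φ ψ 1 / φ ts.length) +
        (ts.map fun t => (t.vertices.map (vertexConnectivity b φ ψ)).sum).sum := by
  rw [graft, sum_map_vertices_node, ← graft,
    map_shiftConsecutive (F := fun t => (t.vertices.map (vertexConnectivity b φ ψ)).sum)
      (sum_vertexConnectivity_shift b φ ψ)]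
  simp [vertexConnectivity, positions, attachWeight, vertexWeight, cap_graft, deg_graft]

end BucketTree

theorem totalWeight_of_le {b n : ℕ} (φ ψ : ℕ → ℝ) (hn : 1 ≤ n) (hnb : n ≤ b) :
    totalWeight b φ ψ n = bucketWeight b φ ψ n := by
  rw [totalWeight, increasingTrees_eq_singleton hn hnb, Finset.sum_singleton, weight_singleton,
    List.length_range']

/-! ### The local form of the weights -/

/-- The local form of the weights: attaching a label to a vertex of capacity `c` and out-degree `k`
multiplies the weight, summed over all positions, by `c₁ c + c₂ (1 - k)`. There are no quotients, so
that weights may vanish. -/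
structure LocalRule (b : ℕ) (φ ψ : ℕ → ℝ) (c₁ c₂ : ℝ) : Prop where
  bucket : ∀ k : ℕ, 1 ≤ k → k < b →
    bucketWeight b φ ψ (k + 1) = (c₁ * k + c₂) * bucketWeight b φ ψ k
  degree : ∀ k : ℕ, ((k : ℝ) + 1) * (φ (k + 1) * bucketWeight b φ ψ 1) =
    (c₁ * b + c₂ * (1 - k)) * φ k

namespace LocalRule

variable {b : ℕ} {φ ψ : ℕ → ℝ} {c₁ c₂ : ℝ}

theorem attachWeight_eq (h : LocalRule b φ ψ c₁ c₂) {v : BucketTree} (hv : IsValidAt b v) :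
    attachWeight b φ ψ v =
      (c₁ * v.cap + c₂ * (1 - v.deg)) / positions b v * vertexWeight b φ ψ v := by
  by_cases hb : v.cap < b
  · have h1 := h.bucket v.cap hv.one_le_cap hb
    have h2 : v.deg = 0 := by
      rw [deg, hv.children_eq_nil hb]
      rfl
    rw [attachWeight, if_pos hb, h1, positions, if_pos hb, vertexWeight, if_pos hb, bucketWeight,
      if_pos hb, h2]
    simp
  · have h1 := h.degree v.deg
    have h2 : v.cap = b := le_antisymm hv.cap_le (not_lt.1 hb)
    have h3 : (v.deg : ℝ) + 1 ≠ 0 := by positivity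
    rw [attachWeight, if_neg hb, positions, if_neg hb, vertexWeight, if_neg hb, h2, Nat.cast_add,
      Nat.cast_one, div_mul_eq_mul_div, eq_div_iff h3, ← h1]
    ring

theorem weight_eq (h : LocalRule b φ ψ c₁ c₂) {x : ℕ} {t v t' : BucketTree}
    (ht : IsValid b t) (hi : Inserts b x t v t') :
    weight b φ ψ t' =
      (c₁ * v.cap + c₂ * (1 - v.deg)) / positions b v * weight b φ ψ t :=
  hi.weight_eq ht (h.attachWeight_eq (ht v hi.mem_vertices))

theorem sum_weight_insertions (h : LocalRule b φ ψ c₁ c₂) {n x : ℕ} {t : BucketTree}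
    (ht : t ∈ increasingTrees b n) :
    ((insertions b x t).map fun g => weight b φ ψ g.2).sum = (c₁ * n + c₂) * weight b φ ψ t := by
  have h1 := (mem_increasingTrees.1 ht).1
  have h2 : (insertions b x t).map (fun g => weight b φ ψ g.2) = (insertions b x t).map
      fun g => (c₁ * g.1.cap + c₂ * (1 - g.1.deg)) / positions b g.1 * weight b φ ψ t :=
    List.map_congr_left fun g hg =>
      h.weight_eq h1 (mem_insertions.1 (show (g.1, g.2) ∈ _ from hg))
  have h3 : (fun v : BucketTree => (positions b v : ℝ) *
      ((c₁ * v.cap + c₂ * (1 - v.deg)) / positions b v)) =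
      fun v => c₁ * v.cap + c₂ * (1 - v.deg) :=
    funext fun v => mul_div_cancel₀ _ (positions_pos b v).ne'
  rw [h2, List.sum_map_mul_right, sum_map_insertions_fst t
    fun v => (c₁ * v.cap + c₂ * (1 - v.deg)) / positions b v, h3, sum_map_linear, length_labels ht]

theorem totalWeight_succ (h : LocalRule b φ ψ c₁ c₂) (hb : 1 ≤ b) {n : ℕ} (hn : 1 ≤ n) :
    totalWeight b φ ψ (n + 1) = (c₁ * n + c₂) * totalWeight b φ ψ n := by
  rw [totalWeight, sum_increasingTrees_succ hb hn, totalWeight, Finset.mul_sum]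
  exact Finset.sum_congr rfl fun t ht => h.sum_weight_insertions ht

theorem pos (h : LocalRule b φ ψ c₁ c₂) (hb : 1 ≤ b) (hT : HasRandomTrees b φ ψ) {n : ℕ}
    (hn : 1 ≤ n) : 0 < c₁ * n + c₂ := by
  have h1 := hT (n + 1) (by omega)
  rw [h.totalWeight_succ hb hn] at h1
  exact pos_of_mul_pos_left h1 (hT n hn).le

theorem hasRandomTrees (h : LocalRule b φ ψ c₁ c₂) (hb : 1 ≤ b)
    (h1 : 0 < bucketWeight b φ ψ 1) (hc : ∀ n : ℕ, 1 ≤ n → 0 < c₁ * n + c₂) :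
    HasRandomTrees b φ ψ := by
  intro n hn
  induction n, hn using Nat.le_induction with
  | base => rwa [totalWeight_of_le φ ψ le_rfl hb]
  | succ n hn ih =>
    rw [h.totalWeight_succ hb hn]
    exact mul_pos (hc n hn) ih

theorem hasAffineRatio (h : LocalRule b φ ψ c₁ c₂) (hb : 1 ≤ b) (hT : HasRandomTrees b φ ψ) :
    HasAffineRatio b φ ψ := by
  refine ⟨hT, c₁, c₂, fun n hn => ?_⟩
  rw [h.totalWeight_succ hb hn, mul_div_cancel_right₀ _ (hT n hn).ne']

end LocalRule

theorem HasRandomTrees.bucketWeight_pos {b : ℕ} {φ ψ : ℕ → ℝ} (hT : HasRandomTrees b φ ψ) {k : ℕ}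
    (hk : 1 ≤ k) (hkb : k ≤ b) : 0 < bucketWeight b φ ψ k :=
  totalWeight_of_le φ ψ hk hkb ▸ hT k hk

theorem bucketWeight_self (b : ℕ) (φ ψ : ℕ → ℝ) : bucketWeight b φ ψ b = φ 0 :=
  if_neg (lt_irrefl b)

/-! ### Weights with affine linear ratio of the total weights -/

namespace BucketTree

theorem length_labels_le_of_mem_children {cs : List BucketTree} {c : BucketTree} (hc : c ∈ cs) :
    c.labels.length ≤ (cs.flatMap labels).length := by
  obtain ⟨A, B, rfl⟩ := List.append_of_mem hc
  simp only [List.flatMap_append, List.flatMap_cons, List.length_append]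
  omega

theorem length_labels_le_of_mem {t v : BucketTree} (hv : v ∈ t.vertices) :
    v.labels.length ≤ t.labels.length := by
  induction t using induction_on_children with
  | h l cs ih =>
    rw [vertices_node, List.mem_cons] at hv
    rcases hv with rfl | hv
    · exact le_rfl
    · obtain ⟨c, hc, hv⟩ := List.mem_flatMap.1 hv
      have h1 := length_labels_le_of_mem_children hc
      rw [labels_node, List.length_append]
      exact (ih c hc hv).trans (by omega)

theorem IsValid.of_mem {b : ℕ} {t v : BucketTree} (ht : IsValid b t) (hv : v ∈ t.vertices) :
    IsValid b v := by
  induction t using induction_on_children with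
  | h l cs ih =>
    rw [vertices_node, List.mem_cons] at hv
    rcases hv with rfl | hv
    · exact ht
    · obtain ⟨c, hc, hv⟩ := List.mem_flatMap.1 hv
      exact ih c hc ((isValid_node.1 ht).2 c hc) hv

theorem IsValid.weight_of_length_eq_one {b : ℕ} (hb : 1 ≤ b) {φ ψ : ℕ → ℝ} {t : BucketTree}
    (ht : IsValid b t) (h : t.labels.length = 1) : weight b φ ψ t = bucketWeight b φ ψ 1 := by
  have h1 := ht.children_eq_nil (h.trans_le hb)
  obtain ⟨l, cs⟩ := t
  obtain rfl : cs = [] := h1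
  rw [labels_node, List.flatMap_nil, List.append_nil] at h
  rw [weight_singleton, h]

end BucketTree

/-- Among the trees of size `b + k`, only the stars have a vertex of out-degree `k` or more. Hence a
change of the weight `φ k` only affects the stars. -/
theorem weight_sub_weight {b k : ℕ} (hb : 1 ≤ b) (hk : 1 ≤ k) {φ φ' ψ : ℕ → ℝ}
    (h : ∀ j < k, φ' j = φ j) {t : BucketTree} (ht : t ∈ increasingTrees b (b + k)) :
    weight b φ ψ t - weight b φ' ψ t =
      if t.deg = k then (φ k - φ' k) * bucketWeight b φ ψ 1 ^ k else 0 := by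
  have hv := (mem_increasingTrees.1 ht).1
  have hlen := length_labels ht
  obtain ⟨l, cs⟩ := t
  obtain ⟨hr, hc⟩ := isValid_node.1 hv
  have hcs : cs ≠ [] := by
    rintro rfl
    have h1 := hr.cap_le
    simp only [labels_node, List.flatMap_nil, List.append_nil] at hlen
    simp only [cap, bucket] at h1
    omega
  have hl : l.length = b := hr.saturated hcs
  have hflat : (cs.flatMap labels).length = k := by
    rw [labels_node, List.length_append] at hlen
    omega
  have hroot : ∀ χ : ℕ → ℝ, vertexWeight b χ ψ (node l cs) = χ cs.length := fun χ =>
    if_neg (show ¬ l.length < b by omega)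
  have hch : cs.map (weight b φ' ψ) = cs.map (weight b φ ψ) := by
    refine List.map_congr_left fun c hcc => congrArg _ (List.map_congr_left fun v hvc => ?_)
    have h0 := (hc c hcc).of_mem hvc
    rw [vertexWeight, vertexWeight]
    split_ifs with hvb
    · rfl
    · refine h _ ?_
      have h1 := h0.cap_add_deg_le
      have h2 := length_labels_le_of_mem hvc
      have h3 := length_labels_le_of_mem_children hcc
      have h4 := h0.self.one_le_cap
      omega
  rw [weight_node, weight_node, hch, hroot, hroot, ← sub_mul]
  have hdeg : cs.length ≤ k := hflat ▸ length_flatMap_labels_ge hc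
  by_cases hd : cs.length = k
  · rw [if_pos (show (node l cs).deg = k from hd), hd]
    congr 1
    have h1 : cs.map (weight b φ ψ) = List.replicate k (bucketWeight b φ ψ 1) := by
      rw [List.eq_replicate_iff]
      refine ⟨by simpa using hd, fun w hw => ?_⟩
      obtain ⟨c, hcc, rfl⟩ := List.mem_map.1 hw
      refine (hc c hcc).weight_of_length_eq_one hb ?_
      have h2 := (hc c hcc).one_le_length
      obtain ⟨A, B, rfl⟩ := List.append_of_mem hcc
      have hA := length_flatMap_labels_ge (cs := A) fun u hu => hc u (by simp [hu])
      have hB := length_flatMap_labels_ge (cs := B) fun u hu => hc u (by simp [hu])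
      simp only [List.flatMap_append, List.flatMap_cons, List.length_append,
        List.length_cons] at hflat hd
      omega
    rw [h1, List.prod_replicate]
  · rw [if_neg (show ¬ (node l cs).deg = k from hd), h _ (lt_of_le_of_ne hdeg hd)]
    simp

theorem exists_star {b : ℕ} (hb : 1 ≤ b) (k : ℕ) :
    ∃ t ∈ increasingTrees b (b + k), t.deg = k := by
  have h1 : node [1] [] ∈ increasingTrees b 1 := bucket_mem_increasingTrees le_rfl hb
  refine ⟨graft b (List.replicate k (node [1] [])), ?_, by simp [deg_graft]⟩
  have h2 := graft_mem_increasingTrees hb (ts := List.replicate k (node [1] [])) fun t ht => by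
    obtain rfl := List.eq_of_mem_replicate ht
    rwa [length_labels h1]
  simpa [length_labels h1] using h2

/-- The bucket-weights and the total weights determine the degree-weights. -/
theorem phi_eq_of_totalWeight_eq {b : ℕ} (hb : 1 ≤ b) {φ φ' ψ : ℕ → ℝ}
    (h1 : 0 < bucketWeight b φ ψ 1) (h0 : φ' 0 = φ 0)
    (h : ∀ n, 1 ≤ n → totalWeight b φ ψ n = totalWeight b φ' ψ n) (k : ℕ) : φ' k = φ k := by
  induction k using Nat.strong_induction_on with
  | _ k ih =>
    rcases Nat.eq_zero_or_pos k with rfl | hk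
    · exact h0
    have h2 := sub_eq_zero.2 (h (b + k) (by omega))
    rw [totalWeight, totalWeight, ← Finset.sum_sub_distrib,
      Finset.sum_congr rfl fun t ht => weight_sub_weight hb hk ih ht, ← Finset.sum_filter,
      Finset.sum_const, nsmul_eq_mul] at h2
    obtain ⟨t, ht, hd⟩ := exists_star hb k
    have h3 : ((increasingTrees b (b + k)).filter fun t => t.deg = k).card ≠ 0 :=
      Finset.card_ne_zero_of_mem (Finset.mem_filter.2 ⟨ht, hd⟩)
    have h4 := (mul_eq_zero.1 h2).resolve_left (by exact_mod_cast h3)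
    exact (sub_eq_zero.1 ((mul_eq_zero.1 h4).resolve_right (pow_pos h1 k).ne')).symm

/-- The degree-weights with initial value `x` that satisfy the local rule, where `y` stands for the
bucket-weight of a single label. -/
noncomputable def localPhi (b : ℕ) (c₁ c₂ x y : ℝ) : ℕ → ℝ
  | 0 => x
  | k + 1 => (c₁ * b + c₂ * (1 - k)) / (((k : ℝ) + 1) * y) * localPhi b c₁ c₂ x y k

theorem HasAffineRatio.exists_localRule {b : ℕ} (hb : 1 ≤ b) {φ ψ : ℕ → ℝ}
    (h : HasAffineRatio b φ ψ) :
    HasRandomTrees b φ ψ ∧ ∃ c₁ c₂, LocalRule b φ ψ c₁ c₂ := by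
  obtain ⟨hT, c₁, c₂, hc⟩ := h
  refine ⟨hT, c₁, c₂, ?_⟩
  have hc' : ∀ n : ℕ, 1 ≤ n →
      totalWeight b φ ψ (n + 1) = (c₁ * n + c₂) * totalWeight b φ ψ n := fun n hn =>
    (div_eq_iff (hT n hn).ne').1 (hc n hn)
  have h1 : 0 < bucketWeight b φ ψ 1 := hT.bucketWeight_pos le_rfl hb
  have hbucket : ∀ k : ℕ, 1 ≤ k → k < b →
      bucketWeight b φ ψ (k + 1) = (c₁ * k + c₂) * bucketWeight b φ ψ k := by
    intro k hk hkb
    rw [← totalWeight_of_le φ ψ hk hkb.le, ← hc' k hk, totalWeight_of_le φ ψ (by omega) hkb]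
  set φ' := localPhi b c₁ c₂ (φ 0) (bucketWeight b φ ψ 1) with hφ'
  have hbw : bucketWeight b φ' ψ = bucketWeight b φ ψ := rfl
  have hL : LocalRule b φ' ψ c₁ c₂ := by
    refine ⟨fun k hk hkb => by rw [hbw]; exact hbucket k hk hkb, fun k => ?_⟩
    have h2 : (k : ℝ) + 1 ≠ 0 := by positivity
    have h3 := h1.ne'
    rw [hbw, show φ' (k + 1) = (c₁ * b + c₂ * (1 - k)) /
      (((k : ℝ) + 1) * bucketWeight b φ ψ 1) * φ' k from rfl]
    field_simp
  have hTT : ∀ n, 1 ≤ n → totalWeight b φ ψ n = totalWeight b φ' ψ n := by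
    intro n hn
    induction n, hn using Nat.le_induction with
    | base => rw [totalWeight_of_le φ ψ le_rfl hb, totalWeight_of_le φ' ψ le_rfl hb, hbw]
    | succ n hn ih => rw [hc' n hn, hL.totalWeight_succ hb hn, ih]
  have hφ : φ' = φ := funext (phi_eq_of_totalWeight_eq hb h1 rfl hTT)
  rwa [hφ] at hL

/-! ### Balanced weights -/

theorem IsBalanced.exists_localRule {b : ℕ} (hb : 1 ≤ b) {φ ψ : ℕ → ℝ}
    (hw : IsWeightPair b φ ψ) (h : IsBalanced b φ ψ) :
    HasRandomTrees b φ ψ ∧ ∃ c₁ c₂, LocalRule b φ ψ c₁ c₂ := by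
  obtain ⟨hT, hbal⟩ := h
  refine ⟨hT, ?_⟩
  have h1 : 0 < bucketWeight b φ ψ 1 := hT.bucketWeight_pos le_rfl hb
  choose! C hC using hbal
  have hC' : ∀ n, 1 ≤ n → ∀ t ∈ increasingTrees b n, weight b φ ψ t ≠ 0 →
      (t.vertices.map (vertexConnectivity b φ ψ)).sum = C n := fun n hn t ht h0 => by
    rw [← connectivity_eq (mem_increasingTrees.1 ht).1]
    exact hC n hn t ht h0
  have hτ : ∀ n, 1 ≤ n → ∃ t ∈ increasingTrees b n, weight b φ ψ t ≠ 0 := fun n hn =>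
    Finset.exists_ne_zero_of_sum_ne_zero (hT n hn).ne'
  have : Nonempty BucketTree := ⟨node [] []⟩
  choose! τ hτmem hτ0 using hτ
  -- the connectivity of a tree whose root has out-degree `ms.length` and subtrees of sizes `ms`
  have key : ∀ ms : List ℕ, (∀ m ∈ ms, 1 ≤ m) → φ ms.length ≠ 0 → C (b + ms.sum) =
      ((ms.length : ℝ) + 1) * (φ (ms.length + 1) * bucketWeight b φ ψ 1 / φ ms.length) +
        (ms.map C).sum := by
    intro ms hms h0
    have h2 : (ms.map τ).map (fun t : BucketTree => t.labels.length) = ms := by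
      rw [List.map_map]
      exact (List.map_congr_left fun m hm => length_labels (hτmem m (hms m hm))).trans
        (List.map_id _)
    have h3 := graft_mem_increasingTrees hb (ts := ms.map τ) fun t ht => by
      obtain ⟨m, hm, rfl⟩ := List.mem_map.1 ht
      rw [length_labels (hτmem m (hms m hm))]
      exact hτmem m (hms m hm)
    rw [h2] at h3
    have h4 : weight b φ ψ (graft b (ms.map τ)) ≠ 0 := by
      rw [weight_graft, List.length_map]
      refine mul_ne_zero h0 (List.prod_ne_zero fun h => ?_)
      obtain ⟨t, ht, ht0⟩ := List.mem_map.1 h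
      obtain ⟨m, hm, rfl⟩ := List.mem_map.1 ht
      exact hτ0 m (hms m hm) ht0
    rw [← hC' _ (by omega) _ h3 h4, sum_vertexConnectivity_graft, List.length_map, List.map_map]
    congr 2
    exact List.map_congr_left fun m hm => hC' m (hms m hm) _ (hτmem m (hms m hm)) (hτ0 m (hms m hm))
  -- exchanging one label between two subtrees of the root shows that `C` is affine
  obtain ⟨k₀, hk₀, hφk₀⟩ := hw.nondegenerate
  obtain ⟨r, rfl⟩ : ∃ r, k₀ = r + 2 := ⟨k₀ - 2, by omega⟩
  have hstep : ∀ m, 1 ≤ m → C (m + 1) = C m + (C 2 - C 1) := by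
    intro m hm
    have h2 := key ((m + 1) :: 1 :: List.replicate r 1)
      (by simp) (by simpa using hφk₀.ne')
    have h3 := key (m :: 2 :: List.replicate r 1)
      (by simp [hm]) (by simpa using hφk₀.ne')
    simp only [List.length_cons, List.sum_cons, List.map_cons] at h2 h3
    rw [show m + 1 + (1 + (List.replicate r 1).sum) = m + (2 + (List.replicate r 1).sum) by ring,
      h3] at h2
    linarith
  obtain ⟨c₁, c₂, hCaff⟩ : ∃ c₁ c₂ : ℝ, ∀ n : ℕ, 1 ≤ n → C n = c₁ * n + c₂ := by
    refine ⟨C 2 - C 1, 2 * C 1 - C 2, fun n hn => ?_⟩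
    induction n, hn using Nat.le_induction with
    | base =>
      push_cast
      ring
    | succ n hn ih =>
      rw [hstep n hn, ih]
      push_cast
      ring
  have hdeg : ∀ k : ℕ, φ k ≠ 0 →
      ((k : ℝ) + 1) * (φ (k + 1) * bucketWeight b φ ψ 1) = (c₁ * b + c₂ * (1 - k)) * φ k := by
    intro k hk
    have h2 := key (List.replicate k 1) (by simp) (by simpa using hk)
    simp only [List.length_replicate, List.sum_replicate, List.map_replicate, smul_eq_mul,
      mul_one, nsmul_eq_mul] at h2
    rw [hCaff _ (by omega), hCaff 1 le_rfl] at h2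
    push_cast at h2
    have h3 : ((k : ℝ) + 1) * (φ (k + 1) * bucketWeight b φ ψ 1 / φ k) =
        c₁ * b + c₂ * (1 - k) := by linarith
    rw [← h3]
    field_simp
  have hbucket : ∀ k : ℕ, 1 ≤ k → k < b →
      bucketWeight b φ ψ (k + 1) = (c₁ * k + c₂) * bucketWeight b φ ψ k := by
    intro k hk hkb
    have h2 := hT.bucketWeight_pos hk hkb.le
    have h3 := hC' k hk _ (bucket_mem_increasingTrees hk hkb.le)
      (by rw [weight_singleton, List.length_range']; exact h2.ne')
    rw [sum_map_vertices_node, hCaff k hk] at h3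
    have h4 : (node (List.range' 1 k) []).cap = k := by simp [cap, BucketTree.bucket]
    simp only [vertexConnectivity, positions, attachWeight, vertexWeight, h4, if_pos hkb,
      List.map_nil, List.sum_nil, add_zero, Nat.cast_one, one_mul] at h3
    have h5 : bucketWeight b φ ψ k = ψ k := if_pos hkb
    rw [← h3, h5, div_mul_cancel₀]
    exact h5 ▸ h2.ne'
  -- the trees of size `b + 1` exist only if roots of degree `1` are allowed
  have hpos : 0 < c₁ * b + c₂ := by
    have h2 := hT (b + 1) (by omega)
    have h3 := bucket_mem_increasingTrees hb (le_refl b)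
    have h4 : weight b φ ψ (node (List.range' 1 b) []) = φ 0 := by
      rw [weight_singleton, List.length_range', bucketWeight_self]
    have h5 := hw.phi_zero_pos
    rw [totalWeight, sum_increasingTrees_succ hb hb, increasingTrees_eq_singleton hb le_rfl,
      Finset.sum_singleton, sum_weight_insertions (mem_increasingTrees.1 h3).1 (h4 ▸ h5.ne'),
      hC' b hb _ h3 (h4 ▸ h5.ne'), h4, hCaff b hb] at h2
    exact pos_of_mul_pos_right h2 h5.le
  refine ⟨c₁, c₂, hbucket, fun k => ?_⟩
  by_cases hk : φ k = 0
  swap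
  · exact hdeg k hk
  -- it remains to exclude that `φ` is positive again after a zero
  rw [hk, mul_zero]
  by_contra hne
  have hk1 : 0 < φ (k + 1) := lt_of_le_of_ne (hw.phi_nonneg _) fun h => hne (by rw [← h]; ring)
  have hex : ∃ i, φ i = 0 := ⟨k, hk⟩
  classical
  obtain ⟨i, hi, hmin⟩ : ∃ i, φ i = 0 ∧ ∀ j < i, φ j ≠ 0 :=
    ⟨Nat.find hex, Nat.find_spec hex, fun j hj => Nat.find_min hex hj⟩
  have hik : i ≤ k := by
    by_contra hlt
    exact hmin k (by omega) hk
  have hd0 := hdeg 0 hw.phi_zero_pos.ne'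
  have hi2 : 2 ≤ i := by
    by_contra hlt
    have h2 : i = 0 ∨ i = 1 := by omega
    rcases h2 with rfl | rfl
    · exact hw.phi_zero_pos.ne' hi
    · rw [zero_add, hi] at hd0
      have : 0 < (c₁ * b + c₂ * (1 - (0 : ℕ))) * φ 0 :=
        mul_pos (by simpa using hpos) hw.phi_zero_pos
      simp at hd0 this
      rcases hd0 with hd0 | hd0
      · rw [hd0] at hpos
        exact hpos.false
      · exact hw.phi_zero_pos.ne' hd0
  obtain ⟨i, rfl⟩ : ∃ j, i = j + 2 := ⟨i - 2, by omega⟩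
  have h2 := hdeg (i + 1) (hmin _ (by omega))
  rw [hi, zero_mul, mul_zero] at h2
  have h3 := (mul_eq_zero.1 h2.symm).resolve_right (hmin _ (by omega))
  have h4 := hdeg (k + 1) hk1.ne'
  have h5 : 0 ≤ c₁ * b + c₂ * (1 - (k + 1 : ℕ)) := by
    refine nonneg_of_mul_nonneg_left ?_ hk1
    rw [← h4]
    have := hw.phi_nonneg (k + 1 + 1)
    positivity
  have h6 : (i : ℝ) + 2 ≤ k := by exact_mod_cast hik
  push_cast at h3 h5
  have h7 : c₂ ≤ 0 := by
    by_contra hlt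
    nlinarith
  have h8 : (0 : ℝ) ≤ i := Nat.cast_nonneg i
  nlinarith

/-! ### Growth rules, preservation of randomness, and balance -/

theorem BucketTree.exists_inserts (b x : ℕ) {t v : BucketTree} (hv : v ∈ t.vertices) :
    ∃ t', Inserts b x t v t' := by
  induction t using induction_on_children with
  | h l cs ih =>
    rw [vertices_node, List.mem_cons] at hv
    rcases hv with rfl | hv
    · by_cases hl : l.length < b
      · exact ⟨_, .bucket l cs hl⟩
      · exact ⟨_, .leaf l [] cs hl⟩
    · obtain ⟨c, hc, hv⟩ := List.mem_flatMap.1 hv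
      obtain ⟨c', h⟩ := ih c hc hv
      obtain ⟨A, B, rfl⟩ := List.append_of_mem hc
      exact ⟨_, .child l A B h⟩

theorem IsWeightPair.weight_nonneg {b : ℕ} {φ ψ : ℕ → ℝ} (hw : IsWeightPair b φ ψ)
    {t : BucketTree} (ht : IsValid b t) : 0 ≤ weight b φ ψ t := by
  refine List.prod_nonneg fun w hw' => ?_
  obtain ⟨v, hv, rfl⟩ := List.mem_map.1 hw'
  rw [vertexWeight]
  split_ifs with h
  · exact hw.psi_nonneg _ (ht v hv).one_le_cap h
  · exact hw.phi_nonneg _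

theorem HasGrowthRule.isBalanced {b : ℕ} (hb : 1 ≤ b) {φ ψ : ℕ → ℝ}
    (h : HasGrowthRule b φ ψ) : IsBalanced b φ ψ := by
  obtain ⟨hT, p, hp⟩ := h
  refine ⟨hT, fun n hn => ⟨totalWeight b φ ψ (n + 1) / totalWeight b φ ψ n, fun t ht h0 => ?_⟩⟩
  have hv := (mem_increasingTrees.1 ht).1
  have hTn := (hT n hn).ne'
  have hTn' := (hT (n + 1) (by omega)).ne'
  have h1 := sum_weight_insertions (x := n + 1) hv h0
  have h2 : (insertions b (n + 1) t).map (fun g => weight b φ ψ g.2) =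
      (insertions b (n + 1) t).map fun g => totalWeight b φ ψ (n + 1) / totalWeight b φ ψ n *
        weight b φ ψ t * (p t g.1 / positions b g.1) := by
    refine List.map_congr_left fun g hg => ?_
    have hg : Inserts b (n + 1) t g.1 g.2 := mem_insertions.1 hg
    have h3 := (hp n hn).2 g.2 (hg.mem_increasingTrees hb ht)
    rw [insertionStep_eq ht hg, treeProb, treeProb, eq_div_iff hTn'] at h3
    rw [← h3]
    ring
  have h3 : (fun v : BucketTree => (positions b v : ℝ) * (p t v / positions b v)) = p t :=
    funext fun v => mul_div_cancel₀ _ (positions_pos b v).ne'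
  rw [h2, List.sum_map_mul_left, sum_map_insertions_fst t fun v => p t v / positions b v, h3,
    ((hp n hn).1 t ht).2, mul_one, mul_comm] at h1
  rw [connectivity_eq hv]
  exact (mul_left_cancel₀ h0 h1).symm

theorem PreservesRandomness.isBalanced {b : ℕ} (hb : 1 ≤ b) {φ ψ : ℕ → ℝ}
    (h : PreservesRandomness b φ ψ) : IsBalanced b φ ψ := by
  obtain ⟨hT, hp⟩ := h
  refine ⟨hT, fun n hn => ⟨totalWeight b φ ψ (n + 1) / totalWeight b φ ψ n, fun t ht h0 => ?_⟩⟩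
  have hv := (mem_increasingTrees.1 ht).1
  have hTn := (hT n hn).ne'
  have hTn' := (hT (n + 1) (by omega)).ne'
  have h1 := hp (n + 1) n hn (by omega) t ht
  rw [sum_filter_restrict hb hn ht] at h1
  simp only [treeProb, div_eq_mul_inv] at h1
  rw [List.sum_map_mul_right, sum_weight_insertions hv h0, ← connectivity_eq hv] at h1
  field_simp at h1 ⊢
  linarith

namespace LocalRule

variable {b : ℕ} {φ ψ : ℕ → ℝ} {c₁ c₂ : ℝ}

theorem treeProb_eq (h : LocalRule b φ ψ c₁ c₂) (hb : 1 ≤ b) {n : ℕ} (hn : 1 ≤ n)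
    {t v t' : BucketTree} (ht : t ∈ increasingTrees b n) (hi : Inserts b (n + 1) t v t') :
    treeProb b φ ψ (n + 1) t' = treeProb b φ ψ n t *
      ((c₁ * v.cap + c₂ * (1 - v.deg)) / (c₁ * n + c₂) / positions b v) := by
  rw [treeProb, h.weight_eq (mem_increasingTrees.1 ht).1 hi, h.totalWeight_succ hb hn, treeProb]
  simp only [div_eq_mul_inv, mul_inv]
  ring

theorem preservesRandomness (h : LocalRule b φ ψ c₁ c₂) (hb : 1 ≤ b)
    (hT : HasRandomTrees b φ ψ) : PreservesRandomness b φ ψ := by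
  classical
  refine ⟨hT, fun n j hj hjn t₀ ht₀ => ?_⟩
  rw [Finset.sum_filter]
  induction n, hjn using Nat.le_induction with
  | base =>
    rw [Finset.sum_eq_single_of_mem t₀ ht₀]
    · rw [if_pos]
      exact restrict_eq_self (mem_increasingTrees.1 ht₀).1
        fun x hx => Nat.lt_succ_iff.1 (lt_of_mem_labels ht₀ hx)
    · intro t ht hne
      rw [if_neg]
      rwa [restrict_eq_self (mem_increasingTrees.1 ht).1
        fun x hx => Nat.lt_succ_iff.1 (lt_of_mem_labels ht hx)]
  | succ n hjn ih =>
    have hn : 1 ≤ n := hj.trans hjn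
    rw [← ih, sum_increasingTrees_succ hb hn]
    refine Finset.sum_congr rfl fun t ht => ?_
    have h1 : (insertions b (n + 1) t).map (fun g => if restrict j g.2 = t₀ then
        treeProb b φ ψ (n + 1) g.2 else 0) = (insertions b (n + 1) t).map
        fun g => weight b φ ψ g.2 * (if restrict j t = t₀ then
          (totalWeight b φ ψ (n + 1))⁻¹ else 0) := by
      refine List.map_congr_left fun g hg => ?_
      have hg : Inserts b (n + 1) t g.1 g.2 := mem_insertions.1 hg
      rw [← restrict_restrict hjn g.2, hg.restrict_of_mem ht, treeProb, div_eq_mul_inv, mul_ite,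
        mul_zero]
    rw [h1, List.sum_map_mul_right, h.sum_weight_insertions ht, h.totalWeight_succ hb hn, treeProb]
    have h2 := (h.pos hb hT hn).ne'
    have h3 := (hT n hn).ne'
    split_ifs
    · field_simp
    · simp

end LocalRule

/-! ### The three models -/

namespace TreeModel

/-- The model is linear: a vertex of capacity `c` and out-degree `k` attracts the next label with
probability proportional to `slope * c + intercept * (1 - k)`. -/
noncomputable def slope : TreeModel → ℝ
  | recursive => 1
  | ary d => d - 1
  | planeOriented α => α + 1

/-- The coefficient of `1 - k` in the attraction of a vertex of out-degree `k`. -/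
noncomputable def intercept : TreeModel → ℝ
  | recursive => 0
  | ary _ => 1
  | planeOriented _ => -1

theorem attraction_eq (M : TreeModel) (n : ℕ) (v : BucketTree) :
    M.attraction n v = (M.slope * v.cap + M.intercept * (1 - v.deg)) /
      (M.slope * n + M.intercept) := by
  cases M <;> simp only [attraction, slope, intercept] <;> congr 1 <;> ring

theorem Valid.slope_pos {b : ℕ} {M : TreeModel} (h : M.Valid b) : 0 < M.slope := by
  cases M with
  | recursive => exact one_pos
  | ary d =>
    have : (1 : ℝ) < d := by exact_mod_cast h.1
    simpa [slope] using this
  | planeOriented α => exact add_pos h one_pos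

theorem Valid.slope_add_intercept_pos {b : ℕ} {M : TreeModel} (h : M.Valid b) :
    0 < M.slope + M.intercept := by
  cases M with
  | recursive => simp [slope, intercept]
  | ary d => simpa [slope, intercept] using h.slope_pos.trans (lt_add_one _)
  | planeOriented α =>
    have h : 0 < α := h
    simpa [slope, intercept] using h

theorem Valid.pos {b : ℕ} {M : TreeModel} (h : M.Valid b) {n : ℕ} (hn : 1 ≤ n) :
    0 < M.slope * n + M.intercept := by
  have h1 : (1 : ℝ) ≤ n := by exact_mod_cast hn
  have h2 := h.slope_pos
  have h3 := h.slope_add_intercept_pos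
  nlinarith

theorem choose_succ_mul (r : ℝ) (k : ℕ) :
    ((k : ℝ) + 1) * Ring.choose r (k + 1) = (r - k) * Ring.choose r k := by
  have h := Ring.choose_smul_choose r (Nat.le_succ k)
  rw [Nat.succ_eq_add_one, Nat.choose_succ_self_right, Nat.add_sub_cancel_left,
    Ring.choose_one_right, nsmul_eq_mul] at h
  push_cast at h
  rw [h, mul_comm]

theorem choose_succ_mul' (r : ℝ) (k : ℕ) :
    ((k : ℝ) + 1) * Ring.choose (r + 1) (k + 1) = (r + 1) * Ring.choose r k := by
  have h := Ring.choose_smul_choose (r + 1) (show 1 ≤ k + 1 by omega)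
  rw [Nat.choose_one_right, Nat.add_sub_cancel, Ring.choose_one_right, nsmul_eq_mul] at h
  push_cast at h
  rw [h, add_sub_cancel_right]

theorem psi_one (M : TreeModel) : M.psi 1 = 1 := by
  cases M <;> simp [psi]

theorem psi_self {b : ℕ} (M : TreeModel) : M.psi b = M.phi b 0 := by
  cases M <;> simp [psi, phi]

theorem bucketWeight_eq {b k : ℕ} (M : TreeModel) (hk : k ≤ b) :
    bucketWeight b (M.phi b) M.psi k = M.psi k := by
  rw [bucketWeight]
  split_ifs with h
  · rfl
  · rw [← psi_self, le_antisymm hk (not_lt.1 h)]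

/-- The recursion of the bucket-weights of the models with `c₂ ≠ 0`, where `y = ± 1 / x`. -/
theorem factorial_mul_choose_succ {x y : ℝ} (j : ℕ) :
    ((j + 1).factorial : ℝ) * x ^ (j + 1) * Ring.choose ((j : ℝ) + y + 1) (j + 1) =
      (x * ((j : ℝ) + 1) + x * y) * ((j.factorial : ℝ) * x ^ j * Ring.choose ((j : ℝ) + y) j) := by
  rw [Nat.factorial_succ, pow_succ]
  push_cast
  linear_combination ((j.factorial : ℝ) * x ^ j * x) * choose_succ_mul' ((j : ℝ) + y) j

theorem Valid.localRule {b : ℕ} (hb : 1 ≤ b) {M : TreeModel} (h : M.Valid b) :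
    LocalRule b (M.phi b) M.psi M.slope M.intercept := by
  refine ⟨fun k hk hkb => ?_, fun k => ?_⟩
  · rw [bucketWeight_eq M (show k + 1 ≤ b from hkb), bucketWeight_eq M hkb.le]
    obtain ⟨j, rfl⟩ : ∃ j, k = j + 1 := ⟨k - 1, by omega⟩
    cases M with
    | recursive =>
      simp only [psi, slope, intercept, Nat.add_sub_cancel]
      rw [Nat.factorial_succ]
      push_cast
      ring
    | ary d =>
      have h1 : (d : ℝ) - 1 ≠ 0 := h.slope_pos.ne'
      have h2 := factorial_mul_choose_succ (x := (d : ℝ) - 1) (y := 1 / ((d : ℝ) - 1)) j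
      rw [mul_one_div_cancel h1] at h2
      simp only [psi, slope, intercept, Nat.add_sub_cancel]
      push_cast
      rw [show (j : ℝ) + 1 + 1 - 1 + 1 / ((d : ℝ) - 1) = j + 1 / ((d : ℝ) - 1) + 1 by ring,
        add_sub_cancel_right]
      exact h2
    | planeOriented α =>
      have h1 : α + 1 ≠ 0 := h.slope_pos.ne'
      have h2 := factorial_mul_choose_succ (x := α + 1) (y := -(1 / (α + 1))) j
      rw [mul_neg, mul_one_div_cancel h1] at h2
      simp only [psi, slope, intercept, Nat.add_sub_cancel]
      push_cast
      rw [show (j : ℝ) + 1 + 1 - 1 - 1 / (α + 1) = j + -(1 / (α + 1)) + 1 by ring,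
        add_sub_cancel_right, sub_eq_add_neg (j : ℝ)]
      exact h2
  · rw [bucketWeight_eq M hb, psi_one, mul_one]
    cases M with
    | recursive =>
      have h1 : ((k.factorial : ℕ) : ℝ) ≠ 0 := by positivity
      have h2 : (k : ℝ) + 1 ≠ 0 := by positivity
      simp only [phi, slope, intercept, Nat.factorial_succ, pow_succ]
      push_cast
      field_simp
      ring
    | ary d =>
      have h1 := choose_succ_mul ((b : ℝ) * ((d : ℝ) - 1) + 1) k
      simp only [phi, slope, intercept]
      linear_combination (((b - 1).factorial : ℝ) * ((d : ℝ) - 1) ^ (b - 1) *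
        Ring.choose ((b : ℝ) - 1 + 1 / ((d : ℝ) - 1)) (b - 1)) * h1
    | planeOriented α =>
      have h1 := choose_succ_mul' ((α + 1) * (b : ℝ) - 2 + k) k
      simp only [phi, slope, intercept]
      push_cast
      rw [← add_assoc]
      linear_combination (((b - 1).factorial : ℝ) * (α + 1) ^ (b - 1) *
        Ring.choose ((b : ℝ) - 1 - 1 / (α + 1)) (b - 1)) * h1

theorem Valid.isWeightPair {b : ℕ} (hb : 1 ≤ b) {M : TreeModel} (h : M.Valid b) :
    IsWeightPair b (M.phi b) M.psi := by
  have hL := h.localRule hb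
  have h1 : bucketWeight b (M.phi b) M.psi 1 = 1 := by rw [bucketWeight_eq M hb, psi_one]
  have hT := hL.hasRandomTrees hb (h1 ▸ one_pos) fun n hn => h.pos hn
  have h0 : 0 < M.phi b 0 := bucketWeight_self b (M.phi b) M.psi ▸ hT.bucketWeight_pos hb le_rfl
  have hdeg := hL.degree
  simp only [h1, mul_one] at hdeg
  have hbpos : (0 : ℝ) < b := by exact_mod_cast hb
  have hsucc : ∀ k : ℕ, 0 ≤ M.slope * b + M.intercept * (1 - k) → 0 ≤ M.phi b k →
      0 ≤ M.phi b (k + 1) := by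
    intro k h2 h3
    refine nonneg_of_mul_nonneg_right ((hdeg k).symm ▸ mul_nonneg h2 h3) (by positivity)
  refine ⟨?_, h0, fun k hk hkb => ?_, 2, le_rfl, ?_⟩
  · cases M with
    | recursive =>
      intro k
      simp only [phi]
      positivity
    | ary d =>
      obtain ⟨-, m, hm⟩ := h
      have hm' : (b : ℝ) * ((d : ℝ) - 1) + 1 = ((m + 1 : ℕ) : ℝ) := by
        have : ((d : ℝ) - 1) * b = m := by exact_mod_cast hm
        push_cast
        linarith
      intro k
      simp only [phi, hm', Ring.choose_natCast] at h0 ⊢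
      simp only [Nat.choose_zero_right, Nat.cast_one, mul_one] at h0
      exact mul_nonneg h0.le (Nat.cast_nonneg _)
    | planeOriented α =>
      intro k
      induction k with
      | zero => exact h0.le
      | succ k ih =>
        refine hsucc k ?_ ih
        have h2 := h.pos hb
        have h3 : (0 : ℝ) ≤ k := Nat.cast_nonneg k
        simp only [slope, intercept] at h2 ⊢
        linarith
  · have := hT.bucketWeight_pos hk hkb.le
    rw [bucketWeight_eq M hkb.le] at this
    exact this.le
  · have h2 := hdeg 0
    have h3 := hdeg 1
    norm_num at h2 h3
    have h4 : 0 < M.phi b 1 := h2 ▸ mul_pos (h.pos hb) h0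
    have h5 := mul_pos (mul_pos h.slope_pos hbpos) h4
    rw [← h3] at h5
    linarith

end TreeModel

/-- The scaling by `a` and `s` multiplies both constants of the local rule by `a`. -/
theorem IsModelledBy.localRule {b : ℕ} (hb : 1 ≤ b) {φ ψ : ℕ → ℝ} {M : TreeModel}
    (hM : M.Valid b) (h : IsModelledBy b φ ψ M) : 0 < bucketWeight b φ ψ 1 ∧
      ∃ a, 0 < a ∧ LocalRule b φ ψ (a * M.slope) (a * M.intercept) := by
  obtain ⟨a, s, ha, hs, hφ, hψ⟩ := h
  have hL := hM.localRule hb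
  have hbw : ∀ k, 1 ≤ k → k ≤ b → bucketWeight b φ ψ k = a ^ k * s⁻¹ * M.psi k := by
    intro k hk hkb
    rw [bucketWeight]
    split_ifs with hlt
    · exact hψ k hk hlt
    · obtain rfl : k = b := le_antisymm hkb (not_lt.1 hlt)
      rw [hφ, ← M.psi_self]
      simp
  have h1 : bucketWeight b φ ψ 1 = a * s⁻¹ := by
    rw [hbw 1 le_rfl hb, M.psi_one, pow_one, mul_one]
  refine ⟨h1 ▸ mul_pos ha (inv_pos.2 hs), a, ha, fun k hk hkb => ?_, fun k => ?_⟩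
  · have h2 := hL.bucket k hk hkb
    rw [M.bucketWeight_eq (show k + 1 ≤ b from hkb), M.bucketWeight_eq hkb.le] at h2
    rw [hbw (k + 1) (by omega) hkb, hbw k hk hkb.le, h2]
    ring
  · have h2 := hL.degree k
    rw [M.bucketWeight_eq hb, M.psi_one, mul_one] at h2
    have h3 : s ^ (((k + 1 : ℕ) : ℤ) - 1) = s ^ ((k : ℤ) - 1) * s := by
      rw [← zpow_add_one₀ hs.ne']
      congr 1
      push_cast
      ring
    rw [h1, hφ, hφ, h3]
    field_simp
    linear_combination h2

theorem LocalRule.isModelledBy {b : ℕ} (hb : 1 ≤ b) {φ ψ : ℕ → ℝ} {M : TreeModel}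
    (hM : M.Valid b) {a : ℝ} (ha : 0 < a) (h1 : 0 < bucketWeight b φ ψ 1)
    (h : LocalRule b φ ψ (a * M.slope) (a * M.intercept)) : IsModelledBy b φ ψ M := by
  have hL := hM.localRule hb
  have hbw : ∀ k, 1 ≤ k → k ≤ b →
      bucketWeight b φ ψ k = a ^ k * (a / bucketWeight b φ ψ 1)⁻¹ * M.psi k := by
    intro k hk
    induction k, hk using Nat.le_induction with
    | base =>
      intro _
      rw [M.psi_one]
      field_simp
    | succ k hk ih =>
      intro hkb
      have h2 := hL.bucket k hk hkb
      rw [M.bucketWeight_eq (show k + 1 ≤ b from hkb), M.bucketWeight_eq (by omega)] at h2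
      rw [h.bucket k hk hkb, ih (by omega), h2]
      ring
  have hs : 0 < a / bucketWeight b φ ψ 1 := div_pos ha h1
  refine ⟨a, a / bucketWeight b φ ψ 1, ha, hs, fun k => ?_, fun k hk hkb => ?_⟩
  · induction k with
    | zero =>
      rw [← bucketWeight_self b φ ψ, hbw b hb le_rfl, M.psi_self]
      simp
    | succ k ih =>
      have h2 := hL.degree k
      rw [M.bucketWeight_eq hb, M.psi_one, mul_one] at h2
      have h3 := h.degree k
      have h4 : ((k : ℝ) + 1) * bucketWeight b φ ψ 1 ≠ 0 := by positivity
      have h5 : (a / bucketWeight b φ ψ 1) ^ (((k + 1 : ℕ) : ℤ) - 1) * bucketWeight b φ ψ 1 =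
          (a / bucketWeight b φ ψ 1) ^ ((k : ℤ) - 1) * a := by
        rw [show (((k + 1 : ℕ) : ℤ) - 1) = ((k : ℤ) - 1) + 1 by push_cast; ring,
          zpow_add_one₀ hs.ne', mul_assoc, div_mul_cancel₀ _ h1.ne']
      refine mul_left_cancel₀ h4 ?_
      rw [ih] at h3
      linear_combination h3 - a ^ b * (a / bucketWeight b φ ψ 1) ^ ((k : ℤ) - 1) * a * h2 -
        ((k : ℝ) + 1) * a ^ b * M.phi b (k + 1) * h5
  · rw [← hbw k hk hkb.le, bucketWeight, if_pos hkb]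

/-! ### The tree evolution processes -/

theorem evolutionLaw_succ {b : ℕ} (p : ℕ → BucketTree → ℝ) {n : ℕ} (hn : 1 ≤ n)
    {t v t' : BucketTree} (ht : t ∈ increasingTrees b n) (hi : Inserts b (n + 1) t v t') :
    evolutionLaw b p (n + 1) t' = evolutionLaw b p n t * (p n v / positions b v) := by
  obtain ⟨m, rfl⟩ : ∃ m, n = m + 1 := ⟨n - 1, by omega⟩
  rw [evolutionLaw, insertionStep_eq ht hi]

theorem IsModelledBy.isGeneratedBy {b : ℕ} (hb : 1 ≤ b) {φ ψ : ℕ → ℝ} {M : TreeModel}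
    (hM : M.Valid b) (h : IsModelledBy b φ ψ M) : IsGeneratedBy b φ ψ M := by
  obtain ⟨h1, a, ha, hL⟩ := h.localRule hb hM
  have hpos : ∀ n : ℕ, 1 ≤ n → 0 < a * M.slope * n + a * M.intercept := fun n hn => by
    have := mul_pos ha (hM.pos hn)
    linarith
  have hT := hL.hasRandomTrees hb h1 hpos
  refine ⟨hT, fun n hn => ?_⟩
  induction n, hn using Nat.le_induction with
  | base =>
    intro t ht
    rw [increasingTrees_eq_singleton le_rfl hb, Finset.mem_singleton] at ht
    subst ht
    rw [treeProb, totalWeight_of_le φ ψ le_rfl hb, weight_singleton, List.length_range',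
      div_self h1.ne']
    simp [evolutionLaw]
  | succ n hn ih =>
    intro t' ht'
    obtain ⟨ht, v, hv⟩ := exists_inserts_of_mem hn ht'
    rw [evolutionLaw_succ _ hn ht hv, ih _ ht, hL.treeProb_eq hb hn ht hv, M.attraction_eq,
      mul_assoc, mul_assoc, ← mul_add, mul_assoc, ← mul_add, mul_div_mul_left _ _ ha.ne']

theorem IsGeneratedBy.treeProb_eq {b : ℕ} (hb : 1 ≤ b) {φ ψ : ℕ → ℝ} {M : TreeModel}
    (h : IsGeneratedBy b φ ψ M) {n : ℕ} (hn : 1 ≤ n) {t v t' : BucketTree}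
    (ht : t ∈ increasingTrees b n) (hi : Inserts b (n + 1) t v t') :
    treeProb b φ ψ (n + 1) t' =
      treeProb b φ ψ n t * (M.attraction n v / positions b v) := by
  rw [← h.2 (n + 1) (by omega) t' (hi.mem_increasingTrees hb ht), ← h.2 n hn t ht,
    evolutionLaw_succ _ hn ht hi]

theorem IsGeneratedBy.hasGrowthRule {b : ℕ} (hb : 1 ≤ b) {φ ψ : ℕ → ℝ}
    (hw : IsWeightPair b φ ψ) {M : TreeModel} (hM : M.Valid b) (h : IsGeneratedBy b φ ψ M) :
    HasGrowthRule b φ ψ := by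
  classical
  have hT := h.1
  -- on trees of weight zero, the attraction of the model may be negative
  refine ⟨hT, fun t v => if weight b φ ψ t = 0 then (t.vertices.length : ℝ)⁻¹ else
    M.attraction t.labels.length v, fun n hn => ⟨fun t ht => ?_, fun t' ht' => ?_⟩⟩
  · beta_reduce
    rw [length_labels ht]
    by_cases h0 : weight b φ ψ t = 0
    · simp only [if_pos h0]
      refine ⟨fun v _ => by positivity, ?_⟩
      rw [List.map_const', List.sum_replicate, nsmul_eq_mul, mul_inv_cancel₀]
      have := List.length_pos_of_mem (self_mem_vertices t)
      positivity
    · simp only [if_neg h0]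
      have hpos : 0 < treeProb b φ ψ n t :=
        div_pos (lt_of_le_of_ne (hw.weight_nonneg (mem_increasingTrees.1 ht).1) (Ne.symm h0))
          (hT n hn)
      refine ⟨fun v hv => ?_, ?_⟩
      · obtain ⟨t', hi⟩ := exists_inserts b (n + 1) hv
        have h1 := h.treeProb_eq hb hn ht hi
        have h2 : 0 ≤ treeProb b φ ψ (n + 1) t' := div_nonneg (hw.weight_nonneg
          (mem_increasingTrees.1 (hi.mem_increasingTrees hb ht)).1) (hT (n + 1) (by omega)).le
        rw [h1] at h2
        have h3 := nonneg_of_mul_nonneg_right h2 hpos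
        have h4 := mul_nonneg h3 (positions_pos b v).le
        rwa [div_mul_cancel₀ _ (positions_pos b v).ne'] at h4
      · simp only [M.attraction_eq, div_eq_mul_inv]
        rw [List.sum_map_mul_right, sum_map_linear, length_labels ht,
          mul_inv_cancel₀ (hM.pos hn).ne']
  · obtain ⟨ht, v, hv⟩ := exists_inserts_of_mem hn ht'
    rw [insertionStep_eq ht hv, h.treeProb_eq hb hn ht hv, length_labels ht]
    by_cases h0 : weight b φ ψ (restrict n t') = 0
    · simp [treeProb, h0]
    · rw [if_neg h0]

theorem IsGeneratedBy.isModelledBy {b : ℕ} (hb : 1 ≤ b) {φ ψ : ℕ → ℝ}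
    (hw : IsWeightPair b φ ψ) {M : TreeModel} (hM : M.Valid b) (h : IsGeneratedBy b φ ψ M) :
    IsModelledBy b φ ψ M := by
  obtain ⟨hT, c₁, c₂, hL⟩ := ((h.hasGrowthRule hb hw hM).isBalanced hb).exists_localRule hb hw
  have h1 : 0 < bucketWeight b φ ψ 1 := hT.bucketWeight_pos le_rfl hb
  have hbpos : (0 : ℝ) < b := by exact_mod_cast hb
  -- compare the attraction of a root of out-degree `1` in a tree of size `b + 1`
  have hs : node [1] [] ∈ increasingTrees b 1 := bucket_mem_increasingTrees le_rfl hb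
  have ht := graft_mem_increasingTrees hb (ts := [node [1] []]) fun t ht => by
    obtain rfl := List.mem_singleton.1 ht
    rwa [length_labels hs]
  rw [List.map_singleton, List.sum_singleton, length_labels hs] at ht
  have hφ1 : φ 1 ≠ 0 := by
    intro h0
    have h2 := hL.degree 0
    have h3 := mul_pos (hL.pos hb hT hb) hw.phi_zero_pos
    simp only [Nat.cast_zero, zero_add, h0, zero_mul, mul_zero, sub_zero, mul_one] at h2
    exact h3.ne h2
  have hP : treeProb b φ ψ (b + 1) (graft b [node [1] []]) ≠ 0 := by
    refine div_ne_zero ?_ (hT _ (by omega)).ne'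
    rw [weight_graft]
    simpa [weight_singleton] using ⟨hφ1, h1.ne'⟩
  obtain ⟨t', hi⟩ := exists_inserts b (b + 1 + 1) (self_mem_vertices (graft b [node [1] []]))
  have h2 := h.treeProb_eq hb (by omega) ht hi
  rw [hL.treeProb_eq hb (by omega) ht hi] at h2
  have h3 := (div_left_inj' (positions_pos b _).ne').1 (mul_left_cancel₀ hP h2)
  have h4 := hL.pos hb hT (show 1 ≤ b + 1 by omega)
  have h5 := hM.pos (show 1 ≤ b + 1 by omega)
  rw [M.attraction_eq, cap_graft, deg_graft, div_eq_div_iff h4.ne' h5.ne'] at h3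
  simp only [List.length_singleton, Nat.cast_one, sub_self, mul_zero, add_zero] at h3
  have h6 : c₁ * M.intercept = M.slope * c₂ := mul_left_cancel₀ hbpos.ne' (by linarith)
  have h7 := hM.slope_pos
  have e1 : c₁ = c₁ / M.slope * M.slope := by field_simp
  have e2 : c₂ = c₁ / M.slope * M.intercept := by
    field_simp
    linarith
  have ha : 0 < c₁ / M.slope := by
    rw [e1, e2, mul_assoc, ← mul_add] at h4
    exact pos_of_mul_pos_left h4 h5.le
  rw [e1, e2] at hL
  exact hL.isModelledBy hb hM ha h1

/-- The sign of `c₂` decides on the model. For `c₂ > 0`, the degree-weights can only be nonnegative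
if `c₁ b + c₂ (1 - k)` vanishes for some `k`, which makes the parameter `d` rational. -/
theorem LocalRule.hasCombinatorialModel {b : ℕ} (hb : 1 ≤ b) {φ ψ : ℕ → ℝ} {c₁ c₂ : ℝ}
    (hw : IsWeightPair b φ ψ) (hT : HasRandomTrees b φ ψ) (h : LocalRule b φ ψ c₁ c₂) :
    HasCombinatorialModel b φ ψ := by
  have h1 : 0 < bucketWeight b φ ψ 1 := hT.bucketWeight_pos le_rfl hb
  have hbpos : (0 : ℝ) < b := by exact_mod_cast hb
  have hdeg := h.degree
  have hc₁ : 0 < c₁ := by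
    have h0 : 0 ≤ c₁ := by
      by_contra hlt
      obtain ⟨n, hn⟩ := exists_nat_gt (c₂ / -c₁)
      rw [div_lt_iff₀ (by linarith)] at hn
      have h3 := h.pos hb hT (show 1 ≤ n + 1 by omega)
      push_cast at h3
      linarith
    refine lt_of_le_of_ne h0 fun h0 => ?_
    subst h0
    obtain ⟨k, hk, hφk⟩ := hw.nondegenerate
    have h2 : ∀ j : ℕ, φ (j + 2) = 0 := by
      intro j
      induction j with
      | zero =>
        have h3 := hdeg 1
        simp only [Nat.cast_one, sub_self, mul_zero, zero_mul, add_zero] at h3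
        have h4 := (mul_eq_zero.1 h3).resolve_left (by norm_num)
        exact (mul_eq_zero.1 h4).resolve_right h1.ne'
      | succ j ih =>
        have h3 := hdeg (j + 2)
        rw [ih, mul_zero] at h3
        have h4 := (mul_eq_zero.1 h3).resolve_left (by positivity)
        exact (mul_eq_zero.1 h4).resolve_right h1.ne'
    obtain ⟨j, rfl⟩ : ∃ j, k = j + 2 := ⟨k - 2, by omega⟩
    exact hφk.ne' (h2 j)
  rcases lt_trichotomy c₂ 0 with hc₂ | hc₂ | hc₂
  · have h2 := h.pos hb hT le_rfl
    have hα : 0 < c₁ / -c₂ - 1 := by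
      rw [sub_pos, lt_div_iff₀ (by linarith)]
      push_cast at h2
      linarith
    refine ⟨.planeOriented (c₁ / -c₂ - 1), hα, LocalRule.isModelledBy hb hα (a := -c₂)
      (by linarith) h1 ?_⟩
    convert h using 1
    · simp only [TreeModel.slope]
      rw [sub_add_cancel, mul_div_cancel₀ _ (neg_ne_zero.2 hc₂.ne)]
    · simp [TreeModel.intercept]
  · refine ⟨.recursive, trivial, LocalRule.isModelledBy hb trivial hc₁ h1 ?_⟩
    convert h using 1
    · simp [TreeModel.slope]
    · simp [TreeModel.intercept, hc₂]
  · obtain ⟨k, hk⟩ : ∃ k : ℕ, c₁ * b + c₂ * (1 - k) = 0 := by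
      by_contra! hne
      have hφ : ∀ k, 0 < φ k := by
        intro k
        refine lt_of_le_of_ne (hw.phi_nonneg k) (Ne.symm ?_)
        induction k with
        | zero => exact hw.phi_zero_pos.ne'
        | succ k ih =>
          intro h0
          have h2 := hdeg k
          rw [h0, zero_mul, mul_zero] at h2
          exact mul_ne_zero (hne k) ih h2.symm
      obtain ⟨k, hk⟩ := exists_nat_gt ((c₁ * b + c₂) / c₂)
      rw [div_lt_iff₀ hc₂] at hk
      have h2 := hdeg k
      have h3 : 0 < ((k : ℝ) + 1) * (φ (k + 1) * bucketWeight b φ ψ 1) := by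
        have := hφ (k + 1)
        positivity
      rw [h2] at h3
      have h4 := pos_of_mul_pos_left h3 (hφ k).le
      linarith
    have hk2 : 2 ≤ k := by
      by_contra hlt
      have h2 : (k : ℝ) ≤ 1 := by exact_mod_cast (show k ≤ 1 by omega)
      have h3 := mul_pos hc₁ hbpos
      nlinarith
    obtain ⟨m, rfl⟩ : ∃ m, k = m + 1 := ⟨k - 1, by omega⟩
    have hm : 1 ≤ m := by omega
    have hbq : (b : ℚ) ≠ 0 := by exact_mod_cast hbpos.ne'
    have hV : (TreeModel.ary (1 + (m : ℚ) / b)).Valid b := by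
      refine ⟨?_, m, ?_⟩
      · have : (0 : ℚ) < (m : ℚ) / b := by positivity
        linarith
      · field_simp
        ring
    refine ⟨_, hV, LocalRule.isModelledBy hb hV hc₂ h1 ?_⟩
    push_cast at hk
    convert h using 1
    · simp only [TreeModel.slope]
      push_cast
      field_simp
      linarith
    · simp [TreeModel.intercept]

theorem theorem1 (b : ℕ) (hb : 1 ≤ b) :
    (∀ φ ψ : ℕ → ℝ, IsWeightPair b φ ψ →
      List.TFAE
        [HasCombinatorialModel b φ ψ,
         HasAffineRatio b φ ψ,
         HasTreeEvolution b φ ψ,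
         HasGrowthRule b φ ψ,
         PreservesRandomness b φ ψ,
         IsBalanced b φ ψ] ∧
      ∀ M : TreeModel, M.Valid b → (IsModelledBy b φ ψ M ↔ IsGeneratedBy b φ ψ M)) ∧
    ∀ M : TreeModel, M.Valid b → IsWeightPair b (M.phi b) M.psi := by
  refine ⟨fun φ ψ hw => ⟨?_, fun M hM =>
    ⟨fun h => h.isGeneratedBy hb hM, fun h => h.isModelledBy hb hw hM⟩⟩,
    fun M hM => hM.isWeightPair hb⟩
  tfae_have 1 → 3 := fun ⟨M, hM, h⟩ => ⟨M, hM, h.isGeneratedBy hb hM⟩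
  tfae_have 3 → 4 := fun ⟨M, hM, h⟩ => h.hasGrowthRule hb hw hM
  tfae_have 4 → 6 := fun h => h.isBalanced hb
  tfae_have 5 → 6 := fun h => h.isBalanced hb
  tfae_have 6 → 5 := fun h => by
    obtain ⟨hT, c₁, c₂, hL⟩ := h.exists_localRule hb hw
    exact hL.preservesRandomness hb hT
  tfae_have 6 → 2 := fun h => by
    obtain ⟨hT, c₁, c₂, hL⟩ := h.exists_localRule hb hw
    exact hL.hasAffineRatio hb hT
  tfae_have 2 → 1 := fun h => by
    obtain ⟨hT, c₁, c₂, hL⟩ := h.exists_localRule hb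
    exact hL.hasCombinatorialModel hb hw hT
  tfae_finish
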